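/- **Theorem (Sample complexity of SOTRGS).** Let $n\ge 2$, let $\xi$ be a random sample with law $\mathcal P$, and let $f(\cdot;\xi):\mathbb R^n\to\mathbb R$ be twice differentiable stochastic component functions of an objective $F:\mathbb R^n\to\mathbb R$ that is bounded below. Let $\|\cdot\|$ be the Euclidean norm of vectors and the spectral norm of matrices, let $\lambda_{\min}$ be the smallest eigenvalue, fix $x_0\in\mathbb R^n$ and put $\Delta_F=F(x_0)-\inf F>0$. Suppose that there are constants $L_0,M_0,\delta>0$ and $L_1,M_1,G_0,G_1,K_0,K_1\ge 0$ such that for all $x,x'\in\mathbb R^n$: 1. $F$ is differentiable, and $\|\nabla F(x)-\nabla F(x')\|\le (L_0+L_1\|\nabla F(x)\|)\|x-x'\|$ whenever $\|x-x'\|\le 1/L_1$; 2. $\mathbb E_\xi[\nabla f(x;\xi)]=\nabla F(x)$ and $\mathbb E_\xi\|\nabla f(x;\xi)-\nabla F(x)\|^2\le G_0^2+G_1^2\|\nabla F(x)\|^2$; 3. $F$ is twice differentiable, $\|\nabla^2F(x)-\nabla^2F(x')\|\le (M_0+M_1\|\nabla F(x)\|)\|x-x'\|$ whenever $\|x-x'\|\le\delta$,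 and $\mathbb E_\xi[\nabla^2 f(x;\xi)]=\nabla^2F(x)$, $\mathbb E_\xi\|\nabla^2 f(x;\xi)-\nabla^2F(x)\|^2\le K_0^2+K_1^2\|\nabla F(x)\|^2$. Let $0<\epsilon<\min\left\{\frac{3}{5M_1+18G_1+12K_1},\frac1{L_1^2}\right\}$ (with $1/0=+\infty$ here and in 1.), let $c>0$ and $T=\lceil c\,\Delta_F\,\epsilon^{-3/2}\rceil$. Run the second-order trust region method from $x_0$: in each iteration $t=0,\dots,T-1$ draw fresh independent batches $\mathcal S_1,\mathcal S_2$ of i.i.d. samples of law $\mathcal P$ with $|\mathcal S_1|=\lceil\epsilon^{-2}\rceil$ and $|\mathcal S_2|=\lceil 22\log(n)\,\epsilon^{-1}\rceil$, set $g_t=\frac1{|\mathcal S_1|}\sum_{\xi\in\mathcal S_1}\nabla f(x_t;\xi)$ and $H_t=\frac1{|\mathcal S_2|}\sum_{\xi\in\mathcal S_2}\nabla^2 f(x_t;\xi)$, let $d_{t+1}$ be a (measurably chosen) global minimizer of $F(x_t)+g_t^Td+\frac12d^TH_td$ over $\|d\|\le\sqrt\epsilon$, and set $x_{t+1}=x_t+d_{t+1}$.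 Let $\bar t$ be uniformly distributed on $\{0,\dots,T-1\}$, independently of the iterates. Then there is a constant $C>0$ that depends only on $L_0,L_1,M_0,M_1,G_0,G_1,K_0,K_1$ and $c$ such that $$\mathbb E\|\nabla F(x_{\bar t+1})\|\le C\epsilon,\qquad \mathbb E\big[\lambda_{\min}(\nabla^2F(x_{\bar t+1}))\big]\ge -C\sqrt\epsilon ,$$ i.e. $x_{\bar t+1}$ is in expectation an $(\epsilon,\sqrt\epsilon)$-second-order stationary point. Moreover, if $\epsilon\le1$ and $\epsilon^{3/2}\le c\,\Delta_F$, then the total number of samples drawn satisfies $$T\,(|\mathcal S_1|+|\mathcal S_2|)\le C\left(\frac{\Delta_F}{\epsilon^{7/2}}+\log (n)\,\frac{\Delta_F}{\epsilon^{5/2}}\right),$$ which is $\mathcal O(\Delta_F\epsilon^{-7/2}+\Delta_F\epsilon^{-5/2})$ for fixed $n$. -/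

import Mathlib

open MeasureTheory ProbabilityTheory

noncomputable section

/-- `ℝⁿ` with the Euclidean norm. -/
abbrev Vec (n : ℕ) : Type := EuclideanSpace ℝ (Fin n)

/-- The Hessian `∇²F(x)` as a linear operator on `ℝⁿ`, i.e. the derivative of the gradient.
Its operator norm is the spectral norm of the Hessian matrix. -/
def hessian {n : ℕ} (F : Vec n → ℝ) (x : Vec n) : Vec n →L[ℝ] Vec n :=
  fderiv ℝ (gradient F) x

/-- The smallest (real) eigenvalue. -/
def lambdaMin {n : ℕ} (A : Vec n →L[ℝ] Vec n) : ℝ :=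
  sInf {μ : ℝ | Module.End.HasEigenvalue (A : Vec n →ₗ[ℝ] Vec n) μ}

def TwiceDifferentiable {n : ℕ} (F : Vec n → ℝ) : Prop :=
  Differentiable ℝ F ∧ Differentiable ℝ (gradient F)

/-- `(L₀, L₁)`-smoothness. The range `‖x - x'‖ ≤ 1 / L₁` is written `L₁ ‖x - x'‖ ≤ 1`, so that
there is no restriction when `L₁ = 0`. -/
def GeneralizedSmooth {n : ℕ} (F : Vec n → ℝ) (L₀ L₁ : ℝ) : Prop :=
  Differentiable ℝ F ∧
    ∀ x x' : Vec n, L₁ * ‖x - x'‖ ≤ 1 →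
      ‖gradient F x - gradient F x'‖ ≤ (L₀ + L₁ * ‖gradient F x‖) * ‖x - x'‖

/-- Second-order generalized smoothness with constants `M₀, M₁` on pairs at distance at most `δ`. -/
def SecondOrderGeneralizedSmooth {n : ℕ} (F : Vec n → ℝ) (δ M₀ M₁ : ℝ) : Prop :=
  TwiceDifferentiable F ∧
    ∀ x x' : Vec n, ‖x - x'‖ ≤ δ →
      ‖hessian F x - hessian F x'‖ ≤ (M₀ + M₁ * ‖gradient F x‖) * ‖x - x'‖

/-- A stochastic component function `f(x; ξ)`: measurable in the sample and twice differentiable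
in `x`. -/
def StochasticComponent {n : ℕ} {Ξ : Type*} [MeasurableSpace Ξ] (f : Vec n → Ξ → ℝ) : Prop :=
  (∀ x, Measurable (f x)) ∧ ∀ ξ, TwiceDifferentiable (fun x => f x ξ)

/-- The stochastic gradient is unbiased and `(G₀, G₁)`-variance-bounded. -/
def GradientVarianceBounded {n : ℕ} {Ξ : Type*} [MeasurableSpace Ξ] (D : Measure Ξ)
    (f : Vec n → Ξ → ℝ) (F : Vec n → ℝ) (G₀ G₁ : ℝ) : Prop :=
  ∀ x : Vec n,
    Integrable (fun ξ => gradient (fun y => f y ξ) x) D ∧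
    ∫ ξ, gradient (fun y => f y ξ) x ∂D = gradient F x ∧
    Integrable (fun ξ => ‖gradient (fun y => f y ξ) x - gradient F x‖ ^ 2) D ∧
    ∫ ξ, ‖gradient (fun y => f y ξ) x - gradient F x‖ ^ 2 ∂D
      ≤ G₀ ^ 2 + G₁ ^ 2 * ‖gradient F x‖ ^ 2

/-- The stochastic Hessian is unbiased and `(K₀, K₁)`-variance-bounded. -/
def HessianVarianceBounded {n : ℕ} {Ξ : Type*} [MeasurableSpace Ξ] (D : Measure Ξ)
    (f : Vec n → Ξ → ℝ) (F : Vec n → ℝ) (K₀ K₁ : ℝ) : Prop :=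
  ∀ x : Vec n,
    Integrable (fun ξ => hessian (fun y => f y ξ) x) D ∧
    ∫ ξ, hessian (fun y => f y ξ) x ∂D = hessian F x ∧
    Integrable (fun ξ => ‖hessian (fun y => f y ξ) x - hessian F x‖ ^ 2) D ∧
    ∫ ξ, ‖hessian (fun y => f y ξ) x - hessian F x‖ ^ 2 ∂D
      ≤ K₀ ^ 2 + K₁ ^ 2 * ‖gradient F x‖ ^ 2

/-- The initial gap `Δ_F = F(x₀) - inf F`. -/
def initialGap {n : ℕ} (F : Vec n → ℝ) (x₀ : Vec n) : ℝ := F x₀ - ⨅ x, F x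

/-- The batch function `f(x; S) = (1/|S|) ∑_{ξ ∈ S} f(x; ξ)`, the batch being a finite family. -/
def batch {n m : ℕ} {Ξ : Type*} (f : Vec n → Ξ → ℝ) (S : Fin m → Ξ) (x : Vec n) : ℝ :=
  (1 / (m : ℝ)) * ∑ i, f x (S i)

/-- The quadratic model `m(d) = F(x) + gᵀ d + (1/2) dᵀ B d`. -/
def trModel {n : ℕ} (c : ℝ) (g : Vec n) (B : Vec n →L[ℝ] Vec n) (d : Vec n) : ℝ :=
  c + inner ℝ g d + (1 / 2) * inner ℝ d (B d)

/-- `d` is a global solution of the trust region subproblem of radius `Δ`. -/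
def IsTRSolution {n : ℕ} (c : ℝ) (g : Vec n) (B : Vec n →L[ℝ] Vec n) (Δ : ℝ) (d : Vec n) : Prop :=
  ‖d‖ ≤ Δ ∧ ∀ d' : Vec n, ‖d'‖ ≤ Δ → trModel c g B d ≤ trModel c g B d'

/-- The samples drawn in one iteration: `m₁` for the gradient and `m₂` for the Hessian. -/
abbrev IterSample (m₁ m₂ : ℕ) : Type := Fin m₁ ⊕ Fin m₂

/-- The number of samples drawn in a run of `T` iterations. -/
def sampleCount (T m₁ m₂ : ℕ) : ℕ := Fintype.card (Fin T × IterSample m₁ m₂)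

/-- A run of `T` iterations of the second-order trust region method (`B_t = H_t`) of constant
radius `Δ`, started at `x₀`, on a probability space `(Ω, P)`. `S t i` is the `i`-th sample drawn in
iteration `t`, `X t` is the iterate `x_t`, and `ℱ t` is the information available before iteration
`t`: the samples of iteration `t` are i.i.d. with law `D`, independent of `ℱ t`, and known at time
`t + 1`. Which global solution of the subproblem is taken is left open, as long as the
choice is a random variable that does not anticipate later samples. -/
structure IsSOTRGSRun {n : ℕ} {Ξ Ω : Type*} [MeasurableSpace Ξ] [mΩ : MeasurableSpace Ω]
    (P : Measure Ω) (D : Measure Ξ) (f : Vec n → Ξ → ℝ) (F : Vec n → ℝ) (x₀ : Vec n) (Δ : ℝ)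
    (T m₁ m₂ : ℕ) (ℱ : Filtration (Fin (T + 1)) mΩ)
    (S : Fin T → IterSample m₁ m₂ → Ω → Ξ) (X : Fin (T + 1) → Ω → Vec n) : Prop where
  sample_known : ∀ t i, Measurable[ℱ t.succ] (S t i)
  sample_law : ∀ t i, P.map (S t i) = D
  sample_iIndep : ∀ t, iIndepFun (S t) P
  sample_fresh : ∀ t : Fin T,
    Indep (ℱ t.castSucc) (MeasurableSpace.comap (fun ω i => S t i ω) inferInstance) P
  iterate_known : ∀ t, Measurable[ℱ t] (X t)
  init : ∀ ω, X 0 ω = x₀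
  step : ∀ (t : Fin T) (ω : Ω), ∃ d : Vec n,
    IsTRSolution (F (X t.castSucc ω))
      (gradient (batch f (fun i => S t (Sum.inl i) ω)) (X t.castSucc ω))
      (hessian (batch f (fun i => S t (Sum.inr i) ω)) (X t.castSucc ω)) Δ d ∧
    X t.succ ω = X t.castSucc ω + d

/-- `τ` is uniformly distributed on `{0, …, T - 1}` and independent of the iterates `X`. -/
def IsUniformIndex {n T : ℕ} {Ω : Type*} [MeasurableSpace Ω] (P : Measure Ω)
    (X : Fin (T + 1) → Ω → Vec n) (τ : Ω → Fin T) : Prop :=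
  Measurable τ ∧ (∀ k, P {ω | τ ω = k} = (T : ENNReal)⁻¹) ∧ IndepFun τ (fun ω t => X t ω) P

end

/-! Put `r = √ε`. A global minimizer `d` of the model over the ball of radius `r` lowers the model
by at least `r‖g + B d‖ / 2`, and also by at least `-r² vᵀBv / 2` for every unit vector `v`. By
Taylor expansion, `g + B d` is `∇F(x + d)`, and `vᵀBv` for a suitable `v` is the smallest eigenvalue
of `∇²F(x + d)`, up to the derivative errors and powers of `r`. So each step decreases `F` by
`r‖∇F(x + d)‖ / 2`, and by `-r² λ_min / 2` at the new point, up to `r ‖g - ∇F‖ + r² ‖B - ∇²F‖ + r³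
(1 + ‖∇F(x)‖)` with constants (`descent_gradient`, `descent_curvature`).

The batch sizes make the expected errors of `g` and `B` of order `r²` and `r`, times `1 + ‖∇F(x)‖`,
so every error is of order `r³ (1 + ‖∇F(x)‖)`. Summed over a run the decreases telescope to at most
the initial gap, which is at most `T r³ / c` (`sum_integral_le_of_descent`). The gradient norms on
the right, shifted by one index, are absorbed into the left because `ε` is small against `M₁, G₁,
K₁`. The left-over gradient at `x₀` is bounded by the gap (`norm_gradient_le_gap`). Once the average
gradient is known to be of order `ε`, the curvature inequality follows without absorption.

The dimension enters only through `log n` in the Hessian batch. This needs a variance bound in the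
spectral norm, `integral_opNorm_sq_sum_eval_le`: symmetrization introduces random signs, and
`mean_norm_signedSum_sq_le` bounds the signed sums through traces of even powers, of order about
`log n`. -/

/-! ### The trust region subproblem -/

section TrustRegion

variable {n : ℕ}

theorem trModel_add (c : ℝ) (g : Vec n) {B : Vec n →L[ℝ] Vec n}
    (hB : (B : Vec n →ₗ[ℝ] Vec n).IsSymmetric) (d e : Vec n) :
    trModel c g B (d + e) =
      trModel c g B d + inner ℝ (g + B d) e + (1 / 2) * inner ℝ e (B e) := by
  have h : inner ℝ d (B e) = inner ℝ (B d) e := (hB d e).symm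
  simp only [trModel, inner_add_left, inner_add_right, map_add, h]
  rw [real_inner_comm e (B d)]
  ring

/-- First-order optimality on the ball. -/
theorem IsTRSolution.inner_nonneg {c : ℝ} {g : Vec n} {B : Vec n →L[ℝ] Vec n} {Δ : ℝ} {d : Vec n}
    (h : IsTRSolution c g B Δ d) (hB : (B : Vec n →ₗ[ℝ] Vec n).IsSymmetric)
    {d' : Vec n} (hd' : ‖d'‖ ≤ Δ) : 0 ≤ inner ℝ (g + B d) (d' - d) := by
  set e := d' - d with he
  set a := inner ℝ (g + B d) e
  set b := inner ℝ e (B e)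
  have key : ∀ s : ℝ, 0 ≤ s → s ≤ 1 → 0 ≤ s * a + (1 / 2) * (s ^ 2 * b) := by
    intro s hs0 hs1
    have hball : ‖d + s • e‖ ≤ Δ := by
      have hconv := convex_closedBall (0 : Vec n) Δ
      have := hconv.add_smul_sub_mem (x := d) (y := d') (by simpa using h.1) (by simpa using hd')
        ⟨hs0, hs1⟩
      simpa [he] using this
    have := h.2 _ hball
    rw [trModel_add c g hB] at this
    simp only [map_smul, inner_smul_left, inner_smul_right, conj_trivial] at this
    have e1 : s * (s * b) = s ^ 2 * b := by ring
    rw [e1] at this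
    linarith
  by_contra hneg
  push Not at hneg
  rcases le_or_gt b 0 with hb | hb
  · have := key 1 (by norm_num) le_rfl
    linarith
  -- Since `s b ≤ -a`, the increment `s a + s² b / 2` is at most `s a / 2 < 0`.
  · set s := min 1 (-a / b)
    have hs : 0 < s := lt_min one_pos (div_pos (by linarith) hb)
    have hsb : s * b ≤ -a := by
      have : s ≤ -a / b := min_le_right _ _
      rwa [le_div_iff₀ hb] at this
    have := key s hs.le (min_le_left _ _)
    nlinarith

/-- Comparison with `-d` gives `⟨g, d⟩ ≤ 0`. First-order optimality against the boundary point
opposite to the residual `g + B d` gives `⟨g + B d, d⟩ ≤ -Δ‖g + B d‖`. The model change is half the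
sum of these two inner products, so no Lagrange multiplier is needed. -/
theorem IsTRSolution.model_decrease_residual {c : ℝ} {g : Vec n} {B : Vec n →L[ℝ] Vec n} {Δ : ℝ}
    {d : Vec n} (h : IsTRSolution c g B Δ d) (hΔ : 0 ≤ Δ)
    (hB : (B : Vec n →ₗ[ℝ] Vec n).IsSymmetric) :
    trModel c g B d ≤ c - (1 / 2) * Δ * ‖g + B d‖ := by
  have hneg : trModel c g B d ≤ trModel c g B (-d) := h.2 _ (by simpa using h.1)
  have hgd : inner ℝ g d ≤ 0 := by
    simp only [trModel, inner_neg_right, map_neg, inner_neg_left] at hneg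
    linarith
  set r := g + B d with hr
  have hrd : inner ℝ r d ≤ -(Δ * ‖r‖) := by
    rcases eq_or_ne r 0 with h0 | h0
    · simp [h0]
    have hn : ‖r‖ ≠ 0 := norm_ne_zero_iff.2 h0
    have hball : ‖-(Δ / ‖r‖) • r‖ ≤ Δ := by
      rw [norm_smul, norm_neg, Real.norm_of_nonneg (by positivity), div_mul_cancel₀ _ hn]
    have := h.inner_nonneg hB hball
    rw [← hr, inner_sub_right, inner_smul_right, real_inner_self_eq_norm_sq] at this
    have e : -(Δ / ‖r‖) * ‖r‖ ^ 2 = -(Δ * ‖r‖) := by field_simp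
    rw [e] at this
    linarith
  have e : trModel c g B d = c + (1 / 2) * inner ℝ g d + (1 / 2) * inner ℝ r d := by
    rw [trModel, hr, inner_add_left, real_inner_comm d (B d)]
    ring
  rw [e]
  linarith

/-- The linear terms cancel when the values at `Δ v` and `-Δ v` are averaged. -/
theorem IsTRSolution.model_decrease_curvature {c : ℝ} {g : Vec n} {B : Vec n →L[ℝ] Vec n} {Δ : ℝ}
    {d : Vec n} (h : IsTRSolution c g B Δ d) (hΔ : 0 ≤ Δ) {v : Vec n} (hv : ‖v‖ = 1) :
    trModel c g B d ≤ c + (1 / 2) * Δ ^ 2 * inner ℝ v (B v) := by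
  have h1 := h.2 (Δ • v) (by rw [norm_smul, hv, Real.norm_of_nonneg hΔ, mul_one])
  have h2 := h.2 (-(Δ • v)) (by rw [norm_neg, norm_smul, hv, Real.norm_of_nonneg hΔ, mul_one])
  simp only [trModel, inner_neg_right, map_neg, inner_neg_left, map_smul, inner_smul_left,
    inner_smul_right, conj_trivial] at h1 h2 ⊢
  nlinarith

end TrustRegion

/-! ### Gradients and Hessians -/

section Hessian

variable {n : ℕ} {F : Vec n → ℝ}

/-- Symmetry holds without continuity of the Hessian, so it covers the component functions, which
are only twice differentiable. -/
theorem TwiceDifferentiable.hessian_isSymmetric (hF : TwiceDifferentiable F) (x : Vec n) :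
    (hessian F x : Vec n →ₗ[ℝ] Vec n).IsSymmetric := by
  intro v w
  let J : Vec n →L[ℝ] StrongDual ℝ (Vec n) := innerSL ℝ
  have h1 : ∀ y, HasFDerivAt F (J (gradient F y)) y :=
    fun y => (hF.1 y).hasGradientAt.hasFDerivAt
  have h2 : HasFDerivAt (fun y => J (gradient F y)) (J.comp (hessian F x)) x :=
    J.hasFDerivAt.comp x (hF.2 x).hasFDerivAt
  have := second_derivative_symmetric h1 h2 v w
  change inner ℝ (hessian F x v) w = inner ℝ (hessian F x w) v at this
  rw [ContinuousLinearMap.coe_coe, this, real_inner_comm]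

theorem TwiceDifferentiable.hasDerivAt_gradient_line (hF : TwiceDifferentiable F) (x d : Vec n)
    (t : ℝ) : HasDerivAt (fun t : ℝ => gradient F (x + t • d)) (hessian F (x + t • d) d) t := by
  have h1 : HasDerivAt (fun t : ℝ => x + t • d) d t := by
    simpa using ((hasDerivAt_id t).smul_const d).const_add x
  exact (hF.2 _).hasFDerivAt.comp_hasDerivAt t h1

theorem hasDerivAt_line (hF : Differentiable ℝ F) (x d : Vec n) (t : ℝ) :
    HasDerivAt (fun t : ℝ => F (x + t • d)) (inner ℝ (gradient F (x + t • d)) d) t := by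
  have h1 : HasDerivAt (fun t : ℝ => x + t • d) d t := by
    simpa using ((hasDerivAt_id t).smul_const d).const_add x
  have := (hF (x + t • d)).hasFDerivAt.comp_hasDerivAt t h1
  rwa [← inner_gradient_left] at this

/-- Taylor expansion of the gradient under a modulus of continuity of the Hessian. -/
theorem TwiceDifferentiable.gradient_taylor (hF : TwiceDifferentiable F) {x d : Vec n} {α β : ℝ}
    (hH : ∀ t ∈ Set.Icc (0 : ℝ) 1,
      ‖hessian F (x + t • d) - hessian F x‖ ≤ α * (t * ‖d‖) + β * (t * ‖d‖) ^ 2)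
    {t : ℝ} (ht : t ∈ Set.Icc (0 : ℝ) 1) :
    ‖gradient F (x + t • d) - gradient F x - t • hessian F x d‖ ≤
      α * (t * ‖d‖) ^ 2 / 2 + β * (t * ‖d‖) ^ 3 / 3 := by
  have hder : ∀ t : ℝ, HasDerivAt
      (fun t : ℝ => gradient F (x + t • d) - gradient F x - t • hessian F x d)
      (hessian F (x + t • d) d - hessian F x d) t := by
    intro t
    refine (((hF.hasDerivAt_gradient_line x d t).sub_const (gradient F x)).sub
      ((hasDerivAt_id t).smul_const (hessian F x d))).congr_deriv ?_
    rw [one_smul]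
  -- Derivatives are compared instead of integrated, so no integrability of the Hessian along the
  -- segment is required.
  refine image_norm_le_of_norm_deriv_right_le_deriv_boundary (a := 0) (b := 1)
    (B := fun t => α * (t * ‖d‖) ^ 2 / 2 + β * (t * ‖d‖) ^ 3 / 3)
    (B' := fun t => (α * (t * ‖d‖) + β * (t * ‖d‖) ^ 2) * ‖d‖)
    (fun t _ => (hder t).continuousAt.continuousWithinAt)
    (fun t _ => (hder t).hasDerivWithinAt) (by simp) ?_ ?_ ht
  · intro t
    have h0 : HasDerivAt (fun t : ℝ => t * ‖d‖) ‖d‖ t := by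
      simpa using (hasDerivAt_id t).mul_const ‖d‖
    have := (((h0.pow 2).const_mul α).div_const 2).add (((h0.pow 3).const_mul β).div_const 3)
    refine this.congr_deriv ?_
    simp
    ring
  · intro t ht
    rw [← _root_.sub_apply]
    exact (ContinuousLinearMap.le_opNorm _ _).trans
      (mul_le_mul_of_nonneg_right (hH t ⟨ht.1, ht.2.le⟩) (norm_nonneg _))

/-- Taylor expansion of the function under a modulus of continuity of the Hessian. -/
theorem TwiceDifferentiable.taylor (hF : TwiceDifferentiable F) {x d : Vec n} {α β : ℝ}
    (hH : ∀ t ∈ Set.Icc (0 : ℝ) 1,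
      ‖hessian F (x + t • d) - hessian F x‖ ≤ α * (t * ‖d‖) + β * (t * ‖d‖) ^ 2) :
    F (x + d) ≤ F x + inner ℝ (gradient F x) d + (1 / 2) * inner ℝ d (hessian F x d)
      + (α * ‖d‖ ^ 3 / 6 + β * ‖d‖ ^ 4 / 12) := by
  set b := inner ℝ d (hessian F x d) with hb
  have hder : ∀ t : ℝ, HasDerivAt
      (fun t : ℝ => F (x + t • d) - F x - t * inner ℝ (gradient F x) d - t ^ 2 * (b / 2))
      (inner ℝ (gradient F (x + t • d) - gradient F x - t • hessian F x d) d) t := by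
    intro t
    have := (((hasDerivAt_line hF.1 x d t).sub_const (F x)).sub
      ((hasDerivAt_id t).mul_const (inner ℝ (gradient F x) d))).sub
      ((hasDerivAt_pow 2 t).mul_const (b / 2))
    refine this.congr_deriv ?_
    rw [inner_sub_left, inner_sub_left, inner_smul_left, real_inner_comm d (hessian F x d), ← hb]
    simp
    ring
  have := image_norm_le_of_norm_deriv_right_le_deriv_boundary (a := 0) (b := 1)
    (B := fun t => α * (t * ‖d‖) ^ 3 / 6 + β * (t * ‖d‖) ^ 4 / 12)
    (B' := fun t => (α * (t * ‖d‖) ^ 2 / 2 + β * (t * ‖d‖) ^ 3 / 3) * ‖d‖)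
    (fun t _ => (hder t).continuousAt.continuousWithinAt)
    (fun t _ => (hder t).hasDerivWithinAt) (by simp) ?_ ?_ (Set.right_mem_Icc.2 zero_le_one)
  · have h := (le_abs_self _).trans this
    simp only [one_smul, one_mul, one_pow] at h
    linarith
  · intro t
    have h0 : HasDerivAt (fun t : ℝ => t * ‖d‖) ‖d‖ t := by
      simpa using (hasDerivAt_id t).mul_const ‖d‖
    have := (((h0.pow 3).const_mul α).div_const 6).add (((h0.pow 4).const_mul β).div_const 12)
    refine this.congr_deriv ?_
    simp
    ring
  · intro t ht
    exact (norm_inner_le_norm _ _).trans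
      (mul_le_mul_of_nonneg_right (hF.gradient_taylor hH ⟨ht.1, ht.2.le⟩) (norm_nonneg _))

theorem SecondOrderGeneralizedSmooth.continuous_hessian {δ M₀ M₁ : ℝ} (hδ : 0 < δ)
    (hF : SecondOrderGeneralizedSmooth F δ M₀ M₁) : Continuous (hessian F) := by
  rw [continuous_iff_continuousAt]
  intro x
  rw [ContinuousAt, tendsto_iff_norm_sub_tendsto_zero]
  have hlim : Filter.Tendsto (fun y => (M₀ + M₁ * ‖gradient F x‖) * ‖x - y‖) (nhds x) (nhds 0) := by
    have : Continuous fun y => (M₀ + M₁ * ‖gradient F x‖) * ‖x - y‖ := by fun_prop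
    simpa using this.tendsto x
  refine squeeze_zero' (Filter.Eventually.of_forall fun _ => norm_nonneg _) ?_ hlim
  filter_upwards [Metric.closedBall_mem_nhds x hδ] with y hy
  rw [norm_sub_rev]
  exact hF.2 x y (by rwa [← dist_eq_norm, dist_comm])

theorem GeneralizedSmooth.norm_gradient_le {L₀ L₁ : ℝ} (hF : GeneralizedSmooth F L₀ L₁)
    {x y : Vec n} (hxy : L₁ * ‖y - x‖ ≤ 1) :
    ‖gradient F y‖ ≤ ‖gradient F x‖ + (L₀ + L₁ * ‖gradient F x‖) * ‖y - x‖ := by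
  have h := hF.2 x y (by rwa [norm_sub_rev])
  rw [norm_sub_rev x y] at h
  have := norm_sub_norm_le (gradient F y) (gradient F x)
  rw [norm_sub_rev (gradient F y)] at this
  linarith

/-- The Hessian increments on the whole range of the first-order smoothness. -/
theorem norm_hessian_sub_le {L₀ L₁ M₀ M₁ δ : ℝ} (hL₀ : 0 ≤ L₀) (hL₁ : 0 ≤ L₁) (hM₁ : 0 ≤ M₁)
    (hδ : 0 < δ) (h1 : GeneralizedSmooth F L₀ L₁) (h2 : SecondOrderGeneralizedSmooth F δ M₀ M₁)
    {x d : Vec n} (hd : L₁ * ‖d‖ ≤ 1) :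
    ‖hessian F (x + d) - hessian F x‖ ≤ (M₀ + M₁ * ‖gradient F x‖) * ‖d‖
      + M₁ * (L₀ + L₁ * ‖gradient F x‖) * ‖d‖ ^ 2 := by
  set K := M₀ + M₁ * (‖gradient F x‖ + (L₀ + L₁ * ‖gradient F x‖) * ‖d‖) with hK
  -- The segment is cut into `N` pieces of length at most `δ`. `K` is a Lipschitz constant valid on
  -- all of them, and the `N` increments `K ‖d‖ / N` add up to `K ‖d‖`. Hence `δ` disappears from
  -- all later constants, and the trust region may be larger than `δ`.
  obtain ⟨N, hN⟩ := exists_nat_gt (‖d‖ / δ)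
  have hN0 : 0 < (N : ℝ) := lt_of_le_of_lt (by positivity) hN
  have hstep : ‖d‖ / N ≤ δ := by
    rw [div_lt_iff₀ hδ] at hN
    rw [div_le_iff₀ hN0]
    linarith
  have hdist : ∀ {k : ℕ}, k < N →
      dist (hessian F (x + ((k : ℝ) / N) • d)) (hessian F (x + (((k + 1 : ℕ) : ℝ) / N) • d))
        ≤ K * (‖d‖ / N) := by
    intro k hk
    have e : x + ((k : ℝ) / N) • d - (x + (((k + 1 : ℕ) : ℝ) / N) • d) = -((1 / (N : ℝ)) • d) := by
      rw [add_sub_add_left_eq_sub, ← sub_smul, ← neg_smul]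
      congr 1
      push_cast
      field_simp
      ring
    have hn : ‖x + ((k : ℝ) / N) • d - (x + (((k + 1 : ℕ) : ℝ) / N) • d)‖ = ‖d‖ / N := by
      rw [e, norm_neg, norm_smul, Real.norm_of_nonneg (by positivity)]
      ring
    rw [dist_eq_norm]
    have := h2.2 _ _ (hn.trans_le hstep)
    rw [hn] at this
    refine this.trans (mul_le_mul_of_nonneg_right ?_ (by positivity))
    have hkn : ‖x + ((k : ℝ) / N) • d - x‖ ≤ ‖d‖ := by
      rw [add_sub_cancel_left, norm_smul, Real.norm_of_nonneg (by positivity)]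
      refine mul_le_of_le_one_left (norm_nonneg _) ?_
      rw [div_le_one hN0]
      exact_mod_cast hk.le
    have hg := h1.norm_gradient_le (x := x) (y := x + ((k : ℝ) / N) • d)
      ((mul_le_mul_of_nonneg_left hkn hL₁).trans hd)
    have hg' : ‖gradient F (x + ((k : ℝ) / N) • d)‖
        ≤ ‖gradient F x‖ + (L₀ + L₁ * ‖gradient F x‖) * ‖d‖ :=
      hg.trans (by gcongr)
    rw [hK]
    gcongr
  have := dist_le_range_sum_of_dist_le (f := fun k : ℕ => hessian F (x + ((k : ℝ) / N) • d)) N hdist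
  simp only [Finset.sum_const, Finset.card_range, nsmul_eq_mul, Nat.cast_zero, zero_div, zero_smul,
    add_zero, div_self hN0.ne', one_smul] at this
  rw [dist_comm, dist_eq_norm] at this
  refine this.trans (le_of_eq ?_)
  rw [hK]
  field_simp
  ring

/-- A function bounded below has a small gradient where it is close to its infimum. -/
theorem GeneralizedSmooth.norm_gradient_le_gap {L₀ L₁ : ℝ} (hL₀ : 0 ≤ L₀) (hL₁ : 0 ≤ L₁)
    (hF : GeneralizedSmooth F L₀ L₁) (hb : BddBelow (Set.range F)) (x : Vec n) {r : ℝ}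
    (hr : 0 < r) (hLr : L₁ * r ≤ 1) :
    ‖gradient F x‖ ≤ 4 * initialGap F x / r + L₀ * r := by
  have hgap : ∀ y, F x - F y ≤ initialGap F x := fun y =>
    sub_le_sub_left (ciInf_le hb y) _
  set g := gradient F x with hg
  rcases eq_or_ne g 0 with h0 | h0
  · have h := hgap x
    rw [sub_self] at h
    rw [h0, norm_zero]
    positivity
  have hgn : 0 < ‖g‖ := norm_pos_iff.2 h0
  -- A step of length `r / 2` against the gradient lowers `F` by at least `r‖g‖ / 2 - (L₀ + L₁‖g‖)
  -- r² / 4`. As `L₁ r ≤ 1`, this is at least `r‖g‖ / 4 - L₀ r² / 4`, and it cannot exceed the gap.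
  set d := -(r / 2 / ‖g‖) • g with hd
  have hdn : ‖d‖ = r / 2 := by
    rw [hd, norm_smul, norm_neg, Real.norm_of_nonneg (by positivity)]
    field_simp
  have hgd : inner ℝ g d = -(r / 2 * ‖g‖) := by
    rw [hd, inner_smul_right, real_inner_self_eq_norm_sq]
    field_simp
  have hder : ∀ t : ℝ, HasDerivAt (fun t : ℝ => F (x + t • d) - t * inner ℝ g d)
      (inner ℝ (gradient F (x + t • d) - g) d) t := by
    intro t
    refine ((hasDerivAt_line hF.1 x d t).sub
      ((hasDerivAt_id t).mul_const (inner ℝ g d))).congr_deriv ?_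
    rw [inner_sub_left]
    simp
  have := norm_image_sub_le_of_norm_deriv_right_le_segment (a := 0) (b := 1)
    (C := (L₀ + L₁ * ‖g‖) * (r / 2) * (r / 2))
    (fun t _ => (hder t).continuousAt.continuousWithinAt)
    (fun t _ => (hder t).hasDerivWithinAt) ?_ 1 (Set.right_mem_Icc.2 zero_le_one)
  · have h := (le_abs_self _).trans this
    simp only [one_smul, one_mul, zero_smul, zero_mul, add_zero, sub_zero, mul_one] at h
    have h3 := hgap (x + d)
    rw [hgd] at h
    have h4 : r * ‖g‖ ≤ 4 * initialGap F x + L₀ * r * r := by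
      have : L₁ * r * (r * ‖g‖) ≤ 1 * (r * ‖g‖) := by gcongr
      nlinarith
    rw [div_add' _ _ _ hr.ne', le_div_iff₀ hr]
    linarith
  · intro t ht
    have htd : ‖x + t • d - x‖ ≤ r / 2 := by
      rw [add_sub_cancel_left, norm_smul, Real.norm_of_nonneg ht.1, hdn]
      exact mul_le_of_le_one_left (by positivity) ht.2.le
    rw [norm_sub_rev] at htd
    have h5 := hF.2 x (x + t • d) ((mul_le_mul_of_nonneg_left htd hL₁).trans (by nlinarith))
    rw [norm_sub_rev] at h5
    refine (norm_inner_le_norm _ _).trans ?_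
    rw [hdn]
    refine mul_le_mul_of_nonneg_right (h5.trans ?_) (by positivity)
    gcongr

end Hessian

/-! ### The smallest eigenvalue -/

section LambdaMin

variable {n : ℕ} {A B : Vec n →L[ℝ] Vec n}

theorem lambdaMin_le_inner (hA : (A : Vec n →ₗ[ℝ] Vec n).IsSymmetric) {v : Vec n} (hv : ‖v‖ = 1) :
    lambdaMin A ≤ inner ℝ v (A v) := by
  have hn : Module.finrank ℝ (Vec n) = n := finrank_euclideanSpace_fin
  set b := hA.eigenvectorBasis hn
  -- Boundedness matters: the real `sInf` of a set unbounded below is `0` by convention.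
  have hbdd : BddBelow {μ : ℝ | Module.End.HasEigenvalue (A : Vec n →ₗ[ℝ] Vec n) μ} :=
    (Module.End.finite_hasEigenvalue (A : Vec n →ₗ[ℝ] Vec n)).bddBelow
  have hle : ∀ i, lambdaMin A ≤ hA.eigenvalues hn i := fun i =>
    csInf_le hbdd (by simpa using hA.hasEigenvalue_eigenvalues hn i)
  have hexp : inner ℝ v (A v) = ∑ i, hA.eigenvalues hn i * (inner ℝ (b i) v) ^ 2 := by
    rw [← b.sum_inner_mul_inner v (A v)]
    refine Finset.sum_congr rfl fun i _ => ?_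
    have : inner ℝ (b i) (A v) = hA.eigenvalues hn i * inner ℝ (b i) v := by
      have h1 := hA (b i) v
      simp only [ContinuousLinearMap.coe_coe] at h1
      rw [← h1]
      have h2 := hA.apply_eigenvectorBasis hn i
      simp only [ContinuousLinearMap.coe_coe] at h2
      rw [h2, inner_smul_left]
      simp [b]
    rw [this, real_inner_comm]
    ring
  have hone : ∑ i, (inner ℝ (b i) v) ^ 2 = 1 := by
    have := b.sum_sq_norm_inner_right v
    simpa [hv] using this
  calc lambdaMin A = ∑ i, lambdaMin A * (inner ℝ (b i) v) ^ 2 := by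
        rw [← Finset.mul_sum, hone, mul_one]
    _ ≤ _ := by
        rw [hexp]
        exact Finset.sum_le_sum fun i _ => mul_le_mul_of_nonneg_right (hle i) (sq_nonneg _)

/-- The spectrum is finite, and nonempty because `n > 0`, so its infimum is an eigenvalue. For `n =
0` the infimum would be the default value `0`. -/
theorem exists_lambdaMin_eq_inner (hn : 0 < n) (hA : (A : Vec n →ₗ[ℝ] Vec n).IsSymmetric) :
    ∃ v : Vec n, ‖v‖ = 1 ∧ lambdaMin A = inner ℝ v (A v) := by
  have hfr : Module.finrank ℝ (Vec n) = n := finrank_euclideanSpace_fin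
  have hne : {μ : ℝ | Module.End.HasEigenvalue (A : Vec n →ₗ[ℝ] Vec n) μ}.Nonempty :=
    ⟨_, by simpa using hA.hasEigenvalue_eigenvalues hfr ⟨0, hn⟩⟩
  have hmem := hne.csInf_mem (Module.End.finite_hasEigenvalue (A : Vec n →ₗ[ℝ] Vec n))
  obtain ⟨w, hw⟩ := Module.End.HasEigenvalue.exists_hasEigenvector hmem
  have hw0 : ‖w‖ ≠ 0 := norm_ne_zero_iff.2 hw.2
  have hAw : A w = lambdaMin A • w := hw.apply_eq_smul
  refine ⟨‖w‖⁻¹ • w, by rw [norm_smul, norm_inv, norm_norm, inv_mul_cancel₀ hw0], ?_⟩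
  rw [map_smul, hAw]
  simp only [inner_smul_left, inner_smul_right, real_inner_self_eq_norm_sq, conj_trivial]
  field_simp

theorem abs_inner_apply_le (A : Vec n →L[ℝ] Vec n) {v : Vec n} (hv : ‖v‖ ≤ 1) :
    |inner ℝ v (A v)| ≤ ‖A‖ := by
  refine (abs_real_inner_le_norm _ _).trans ?_
  have h1 := A.le_opNorm v
  have h2 : ‖A‖ * ‖v‖ ≤ ‖A‖ := mul_le_of_le_one_right (norm_nonneg _) hv
  nlinarith [norm_nonneg v, norm_nonneg (A v)]

/-- Weyl's inequality: `A` is tested on a unit eigenvector of `B` for its smallest eigenvalue. -/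
theorem lambdaMin_le_add (hn : 0 < n) (hA : (A : Vec n →ₗ[ℝ] Vec n).IsSymmetric)
    (hB : (B : Vec n →ₗ[ℝ] Vec n).IsSymmetric) : lambdaMin A ≤ lambdaMin B + ‖A - B‖ := by
  obtain ⟨v, hv, he⟩ := exists_lambdaMin_eq_inner hn hB
  have h1 := lambdaMin_le_inner hA hv
  have h2 := (le_abs_self _).trans (abs_inner_apply_le (A - B) hv.le)
  rw [_root_.sub_apply, inner_sub_right] at h2
  linarith

theorem continuous_lambdaMin_hessian (hn : 0 < n) {F : Vec n → ℝ} (hF : TwiceDifferentiable F)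
    (hc : Continuous (hessian F)) : Continuous fun x => lambdaMin (hessian F x) := by
  rw [continuous_iff_continuousAt]
  intro x
  rw [ContinuousAt, tendsto_iff_norm_sub_tendsto_zero]
  refine squeeze_zero (fun _ => norm_nonneg _) (fun y => ?_)
    (tendsto_iff_norm_sub_tendsto_zero.1 (hc.tendsto x))
  have h1 := lambdaMin_le_add hn (hF.hessian_isSymmetric x) (hF.hessian_isSymmetric y)
  have h2 := lambdaMin_le_add hn (hF.hessian_isSymmetric y) (hF.hessian_isSymmetric x)
  rw [norm_sub_rev] at h1
  rw [Real.norm_eq_abs, abs_le]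
  constructor <;> linarith

end LambdaMin

/-! ### One step of the trust region method with inexact derivatives -/

section Step

variable {n : ℕ} {F : Vec n → ℝ}

/-- Taylor bounds on a trust region of radius `r`. -/
theorem taylor_bounds_on_ball {L₀ L₁ M₀ M₁ δ r Q : ℝ} (hL₀ : 0 ≤ L₀) (hL₁ : 0 ≤ L₁)
    (hM₀ : 0 ≤ M₀) (hM₁ : 0 ≤ M₁) (hδ : 0 < δ) (hr : 0 ≤ r) (hLr : L₁ * r ≤ 1)
    (hQ : M₀ + M₁ * L₀ * r ≤ Q) (h1 : GeneralizedSmooth F L₀ L₁)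
    (h2 : SecondOrderGeneralizedSmooth F δ M₀ M₁) {x d : Vec n} (hd : ‖d‖ ≤ r) :
    ‖hessian F (x + d) - hessian F x‖ ≤ r * (Q + 2 * M₁ * ‖gradient F x‖) ∧
    ‖gradient F (x + d) - gradient F x - hessian F x d‖
      ≤ r ^ 2 * (Q / 2 + 5 / 6 * M₁ * ‖gradient F x‖) ∧
    F (x + d) ≤ F x + inner ℝ (gradient F x) d + (1 / 2) * inner ℝ d (hessian F x d)
      + r ^ 3 * (Q / 6 + 1 / 4 * M₁ * ‖gradient F x‖) := by
  set u := ‖gradient F x‖ with hu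
  have hu0 : 0 ≤ u := norm_nonneg _
  have hMQ : 0 ≤ M₁ * L₀ * r := by positivity
  have hH : ∀ t ∈ Set.Icc (0 : ℝ) 1, ‖hessian F (x + t • d) - hessian F x‖
      ≤ (M₀ + M₁ * u) * (t * ‖d‖) + M₁ * (L₀ + L₁ * u) * (t * ‖d‖) ^ 2 := by
    intro t ht
    have e : ‖t • d‖ = t * ‖d‖ := by rw [norm_smul, Real.norm_of_nonneg ht.1]
    have hle : ‖t • d‖ ≤ r := by
      rw [e]
      exact (mul_le_of_le_one_left (norm_nonneg _) ht.2).trans hd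
    have := norm_hessian_sub_le hL₀ hL₁ hM₁ hδ h1 h2 (x := x) (d := t • d)
      ((mul_le_mul_of_nonneg_left hle hL₁).trans hLr)
    rwa [e] at this
  have one : (1 : ℝ) ∈ Set.Icc (0 : ℝ) 1 := Set.right_mem_Icc.2 zero_le_one
  have hMu : 0 ≤ M₁ * u := by positivity
  -- This merges the second-order part of the modulus into the first-order one. The coefficients of
  -- `M₁ u` become `1 + 1`, `1/2 + 1/3` and `1/6 + 1/12`.
  have hLu : M₁ * (L₁ * r) * u ≤ M₁ * u := by
    have := mul_le_mul_of_nonneg_left hLr hMu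
    nlinarith
  refine ⟨?_, ?_, ?_⟩
  · have := hH 1 one
    rw [one_smul, one_mul] at this
    refine this.trans ?_
    calc (M₀ + M₁ * u) * ‖d‖ + M₁ * (L₀ + L₁ * u) * ‖d‖ ^ 2
        ≤ (M₀ + M₁ * u) * r + M₁ * (L₀ + L₁ * u) * r ^ 2 := by gcongr
      _ = r * (M₀ + M₁ * L₀ * r + M₁ * u + M₁ * (L₁ * r) * u) := by ring
      _ ≤ _ := mul_le_mul_of_nonneg_left (by linarith) hr
  · have := h2.1.gradient_taylor hH one
    rw [one_smul, one_mul, one_smul] at this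
    refine this.trans ?_
    calc (M₀ + M₁ * u) * ‖d‖ ^ 2 / 2 + M₁ * (L₀ + L₁ * u) * ‖d‖ ^ 3 / 3
        ≤ (M₀ + M₁ * u) * r ^ 2 / 2 + M₁ * (L₀ + L₁ * u) * r ^ 3 / 3 := by gcongr
      _ = r ^ 2 * (M₀ / 2 + M₁ * L₀ * r / 3 + M₁ * u / 2 + M₁ * (L₁ * r) * u / 3) := by ring
      _ ≤ _ := mul_le_mul_of_nonneg_left (by linarith) (by positivity)
  · refine (h2.1.taylor hH).trans (add_le_add_right ?_ _)
    calc (M₀ + M₁ * u) * ‖d‖ ^ 3 / 6 + M₁ * (L₀ + L₁ * u) * ‖d‖ ^ 4 / 12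
        ≤ (M₀ + M₁ * u) * r ^ 3 / 6 + M₁ * (L₀ + L₁ * u) * r ^ 4 / 12 := by gcongr
      _ = r ^ 3 * (M₀ / 6 + M₁ * L₀ * r / 12 + M₁ * u / 6 + M₁ * (L₁ * r) * u / 12) := by ring
      _ ≤ _ := mul_le_mul_of_nonneg_left (by linarith) (by positivity)

/-- The objective is dominated by the model value, up to the errors of the derivatives. -/
theorem objective_le_trModel {M₁ r Q : ℝ} {x g d : Vec n} {B : Vec n →L[ℝ] Vec n} (hd : ‖d‖ ≤ r)
    (hT : F (x + d) ≤ F x + inner ℝ (gradient F x) d + (1 / 2) * inner ℝ d (hessian F x d)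
      + r ^ 3 * (Q / 6 + 1 / 4 * M₁ * ‖gradient F x‖)) :
    F (x + d) ≤ trModel (F x) g B d + r * ‖g - gradient F x‖ + r ^ 2 / 2 * ‖B - hessian F x‖
      + r ^ 3 * (Q / 6 + 1 / 4 * M₁ * ‖gradient F x‖) := by
  have hr : 0 ≤ r := (norm_nonneg d).trans hd
  have e1 : -(r * ‖g - gradient F x‖) ≤ inner ℝ (g - gradient F x) d := by
    have := (abs_le.1 (abs_real_inner_le_norm (g - gradient F x) d)).1
    have h2 : ‖g - gradient F x‖ * ‖d‖ ≤ ‖g - gradient F x‖ * r := by gcongr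
    linarith
  have e2 : -(r ^ 2 * ‖B - hessian F x‖) ≤ inner ℝ d ((B - hessian F x) d) := by
    have := (abs_le.1 (abs_real_inner_le_norm d ((B - hessian F x) d))).1
    have h2 : ‖d‖ * ‖(B - hessian F x) d‖ ≤ r * (‖B - hessian F x‖ * r) := by
      gcongr
      exact ((B - hessian F x).le_opNorm d).trans (by gcongr)
    linarith
  rw [inner_sub_left] at e1
  rw [_root_.sub_apply, inner_sub_right] at e2
  rw [trModel]
  linarith

/-- `∇F(x + d)` replaces the residual `g + B d` in the model decrease. The derivative errors enter
once through the model and once, halved by `r / 2`, through this replacement: `3/2 = 1 + 1/2` and `1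
= 1/2 + 1/2`. Likewise `2/3 = 1/4 + 5/12`. -/
theorem IsTRSolution.descent_gradient {L₀ L₁ M₀ M₁ δ r Q : ℝ} (hL₀ : 0 ≤ L₀) (hL₁ : 0 ≤ L₁)
    (hM₀ : 0 ≤ M₀) (hM₁ : 0 ≤ M₁) (hδ : 0 < δ) (hr : 0 ≤ r) (hLr : L₁ * r ≤ 1)
    (hQ : M₀ + M₁ * L₀ * r ≤ Q) (h1 : GeneralizedSmooth F L₀ L₁)
    (h2 : SecondOrderGeneralizedSmooth F δ M₀ M₁) {x g d : Vec n} {B : Vec n →L[ℝ] Vec n}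
    (hB : (B : Vec n →ₗ[ℝ] Vec n).IsSymmetric) (h : IsTRSolution (F x) g B r d) :
    F (x + d) - F x + 1 / 2 * r * ‖gradient F (x + d)‖ ≤
      3 / 2 * r * ‖g - gradient F x‖ + r ^ 2 * ‖B - hessian F x‖
        + r ^ 3 * (Q + 2 / 3 * M₁ * ‖gradient F x‖) := by
  obtain ⟨-, hG, hT⟩ := taylor_bounds_on_ball hL₀ hL₁ hM₀ hM₁ hδ hr hLr hQ h1 h2 (x := x) h.1
  have hF := objective_le_trModel (g := g) (B := B) h.1 hT
  have hm := h.model_decrease_residual hr hB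
  have hBd : ‖(B - hessian F x) d‖ ≤ r * ‖B - hessian F x‖ := by
    refine ((B - hessian F x).le_opNorm d).trans ?_
    rw [mul_comm]
    exact mul_le_mul_of_nonneg_right h.1 (norm_nonneg _)
  have hnorm : ‖gradient F (x + d)‖ ≤ ‖g + B d‖ + ‖g - gradient F x‖ + r * ‖B - hessian F x‖
      + r ^ 2 * (Q / 2 + 5 / 6 * M₁ * ‖gradient F x‖) := by
    have e : gradient F (x + d) = (g + B d) - (g - gradient F x) - (B - hessian F x) d
        + (gradient F (x + d) - gradient F x - hessian F x d) := by
      rw [_root_.sub_apply]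
      abel
    have t1 := norm_add_le ((g + B d) - (g - gradient F x) - (B - hessian F x) d)
      (gradient F (x + d) - gradient F x - hessian F x d)
    have t2 := norm_sub_le ((g + B d) - (g - gradient F x)) ((B - hessian F x) d)
    have t3 := norm_sub_le (g + B d) (g - gradient F x)
    rw [← e] at t1
    linarith
  have hQ0 : 0 ≤ r ^ 3 * Q := by
    have : 0 ≤ Q := le_trans (by positivity) hQ
    positivity
  have := mul_le_mul_of_nonneg_left hnorm (show 0 ≤ 1 / 2 * r by positivity)
  linarith

/-- The test direction is a minimal eigenvector of the Hessian at the new point, not of `B`; moving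
back from `∇²F(x + d)` to `B` costs the Hessian increment and the batch error. The constants have
slack, to match the form of the gradient estimate. -/
theorem IsTRSolution.descent_curvature (hn : 0 < n) {L₀ L₁ M₀ M₁ δ r Q : ℝ} (hL₀ : 0 ≤ L₀)
    (hL₁ : 0 ≤ L₁) (hM₀ : 0 ≤ M₀) (hM₁ : 0 ≤ M₁) (hδ : 0 < δ) (hr : 0 ≤ r) (hLr : L₁ * r ≤ 1)
    (hQ : M₀ + M₁ * L₀ * r ≤ Q) (h1 : GeneralizedSmooth F L₀ L₁)
    (h2 : SecondOrderGeneralizedSmooth F δ M₀ M₁) {x g d : Vec n} {B : Vec n →L[ℝ] Vec n}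
    (h : IsTRSolution (F x) g B r d) :
    F (x + d) - F x - 1 / 2 * r ^ 2 * lambdaMin (hessian F (x + d)) ≤
      3 / 2 * r * ‖g - gradient F x‖ + r ^ 2 * ‖B - hessian F x‖
        + r ^ 3 * (Q + 2 * M₁ * ‖gradient F x‖) := by
  obtain ⟨hH, -, hT⟩ := taylor_bounds_on_ball hL₀ hL₁ hM₀ hM₁ hδ hr hLr hQ h1 h2 (x := x) h.1
  have hF := objective_le_trModel (g := g) (B := B) h.1 hT
  obtain ⟨v, hv, hlam⟩ := exists_lambdaMin_eq_inner hn (h2.1.hessian_isSymmetric (x + d))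
  have hm := h.model_decrease_curvature hr hv
  have e1 := (le_abs_self _).trans (abs_inner_apply_le (B - hessian F x) hv.le)
  have e2 := (neg_abs_le _).trans' (neg_le_neg
    (abs_inner_apply_le (hessian F (x + d) - hessian F x) hv.le))
  rw [_root_.sub_apply, inner_sub_right] at e1 e2
  have hQ0 : 0 ≤ Q := le_trans (by positivity) hQ
  have hlow : inner ℝ v (B v) ≤ lambdaMin (hessian F (x + d)) + ‖B - hessian F x‖
      + r * (Q + 2 * M₁ * ‖gradient F x‖) := by
    rw [hlam]
    linarith
  have := mul_le_mul_of_nonneg_left hlow (show 0 ≤ 1 / 2 * r ^ 2 by positivity)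
  have p1 : 0 ≤ r * ‖g - gradient F x‖ := by positivity
  have p2 : 0 ≤ r ^ 3 * Q := by positivity
  have p3 : 0 ≤ r ^ 3 * (M₁ * ‖gradient F x‖) := by positivity
  linarith

end Step

/-! ### A Khintchine inequality for the spectral norm -/

section Khintchine

variable {E : Type*} [NormedAddCommGroup E] [InnerProductSpace ℝ E] [FiniteDimensional ℝ E]

/-! ### Traces of products of powers of symmetric operators -/

namespace LinearMap.IsSymmetric

theorem pow_apply_eigenvectorBasis {A : E →ₗ[ℝ] E} (hA : A.IsSymmetric) {n : ℕ}
    (hn : Module.finrank ℝ E = n) (q : ℕ) (i : Fin n) :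
    (A ^ q) (hA.eigenvectorBasis hn i) =
      hA.eigenvalues hn i ^ q • hA.eigenvectorBasis hn i := by
  induction q with
  | zero => simp
  | succ q ih =>
    rw [pow_succ, Module.End.mul_apply, hA.apply_eigenvectorBasis hn i]
    simp only [map_smul, RCLike.ofReal_real_eq_id, _root_.id]
    rw [ih, smul_smul, pow_succ, mul_comm]

theorem inner_pow_apply_self {A : E →ₗ[ℝ] E} (hA : A.IsSymmetric) {n : ℕ}
    (hn : Module.finrank ℝ E = n) (q : ℕ) (x : E) :
    inner ℝ x ((A ^ q) x) =
      ∑ i, hA.eigenvalues hn i ^ q * inner ℝ (hA.eigenvectorBasis hn i) x ^ 2 := by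
  rw [← (hA.eigenvectorBasis hn).sum_inner_mul_inner x ((A ^ q) x)]
  refine Finset.sum_congr rfl fun i _ => ?_
  rw [← (hA.pow q) (hA.eigenvectorBasis hn i) x, hA.pow_apply_eigenvectorBasis hn, inner_smul_left,
    real_inner_comm, conj_trivial]
  ring

theorem trace_pow {A : E →ₗ[ℝ] E} (hA : A.IsSymmetric) {n : ℕ} (hn : Module.finrank ℝ E = n)
    (q : ℕ) : LinearMap.trace ℝ E (A ^ q) = ∑ i, hA.eigenvalues hn i ^ q := by
  rw [LinearMap.trace_eq_sum_inner _ (hA.eigenvectorBasis hn)]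
  refine Finset.sum_congr rfl fun i _ => ?_
  rw [hA.pow_apply_eigenvectorBasis hn, inner_smul_right]
  simp

/-- The trace of a product of powers of symmetric operators, in terms of their eigenvectors. -/
theorem trace_pow_mul_pow {A B H : E →ₗ[ℝ] E} (hA : A.IsSymmetric) (hB : B.IsSymmetric)
    (hH : H.IsSymmetric) {n : ℕ} (hn : Module.finrank ℝ E = n) (q k : ℕ) :
    LinearMap.trace ℝ E (A ^ q * H * B ^ k * H) =
      ∑ i, ∑ j, hA.eigenvalues hn i ^ q * hB.eigenvalues hn j ^ k *
        inner ℝ (hB.eigenvectorBasis hn j) (H (hA.eigenvectorBasis hn i)) ^ 2 := by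
  rw [LinearMap.trace_eq_sum_inner _ (hA.eigenvectorBasis hn)]
  refine Finset.sum_congr rfl fun i _ => ?_
  simp only [Module.End.mul_apply]
  rw [← (hA.pow q), hA.pow_apply_eigenvectorBasis hn, inner_smul_left, ← hH,
    hB.inner_pow_apply_self hn, Finset.mul_sum, conj_trivial]
  exact Finset.sum_congr rfl fun j _ => by ring

/-- In the two eigenbases the claim reduces to `a^q b^k + a^k b^q ≤ a^(q+k) + b^(q+k)` with
nonnegative weights. As `q + k` is even, `a` and `b` may be replaced by their absolute values, and
the difference then factors as `(|a|^q - |b|^q)(|a|^k - |b|^k) ≥ 0`. -/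
theorem trace_pow_mul_pow_add_le {A B H : E →ₗ[ℝ] E} (hA : A.IsSymmetric) (hB : B.IsSymmetric)
    (hH : H.IsSymmetric) {q k : ℕ} (hqk : Even (q + k)) :
    LinearMap.trace ℝ E (A ^ q * H * B ^ k * H) + LinearMap.trace ℝ E (A ^ k * H * B ^ q * H) ≤
      LinearMap.trace ℝ E (A ^ (q + k) * H * H) + LinearMap.trace ℝ E (B ^ (q + k) * H * H) := by
  have e1 : LinearMap.trace ℝ E (A ^ (q + k) * H * H)
      = LinearMap.trace ℝ E (A ^ (q + k) * H * B ^ 0 * H) := by rw [pow_zero, mul_one]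
  have e2 : LinearMap.trace ℝ E (B ^ (q + k) * H * H)
      = LinearMap.trace ℝ E (A ^ 0 * H * B ^ (q + k) * H) := by
    rw [pow_zero, one_mul, mul_assoc, LinearMap.trace_mul_comm, mul_assoc, mul_assoc,
      LinearMap.trace_mul_comm, mul_assoc]
  rw [e1, e2]
  simp only [hA.trace_pow_mul_pow hB hH rfl, ← Finset.sum_add_distrib]
  refine Finset.sum_le_sum fun i _ => Finset.sum_le_sum fun j _ => ?_
  simp only [← add_mul]
  refine mul_le_mul_of_nonneg_right ?_ (sq_nonneg _)
  set a := hA.eigenvalues rfl i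
  set b := hB.eigenvalues rfl j
  have habs : ∀ x : ℝ, x ^ (q + k) = |x| ^ (q + k) := fun x => (hqk.pow_abs x).symm
  rw [habs a, habs b, pow_zero, pow_zero, mul_one, one_mul]
  have h1 : a ^ q * b ^ k ≤ |a| ^ q * |b| ^ k := by
    rw [← abs_pow, ← abs_pow, ← abs_mul]; exact le_abs_self _
  have h2 : a ^ k * b ^ q ≤ |a| ^ k * |b| ^ q := by
    rw [← abs_pow, ← abs_pow, ← abs_mul]; exact le_abs_self _
  have h3 : 0 ≤ (|a| ^ q - |b| ^ q) * (|a| ^ k - |b| ^ k) := by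
    rcases le_total |a| |b| with h | h
    · exact mul_nonneg_of_nonpos_of_nonpos
        (sub_nonpos.2 (pow_le_pow_left₀ (abs_nonneg _) h _))
        (sub_nonpos.2 (pow_le_pow_left₀ (abs_nonneg _) h _))
    · exact mul_nonneg (sub_nonneg.2 (pow_le_pow_left₀ (abs_nonneg _) h _))
        (sub_nonneg.2 (pow_le_pow_left₀ (abs_nonneg _) h _))
  rw [pow_add, pow_add]
  nlinarith

theorem sum_trace_pow_mul_pow_le {A B H : E →ₗ[ℝ] E} (hA : A.IsSymmetric) (hB : B.IsSymmetric)
    (hH : H.IsSymmetric) {N : ℕ} (hN : Even N) :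
    2 * ∑ q ∈ Finset.range (N + 1), LinearMap.trace ℝ E (A ^ q * H * B ^ (N - q) * H) ≤
      (N + 1) * (LinearMap.trace ℝ E (A ^ N * H * H) + LinearMap.trace ℝ E (B ^ N * H * H)) := by
  have hrefl : ∑ q ∈ Finset.range (N + 1), LinearMap.trace ℝ E (A ^ (N - q) * H * B ^ q * H)
      = ∑ q ∈ Finset.range (N + 1), LinearMap.trace ℝ E (A ^ q * H * B ^ (N - q) * H) := by
    rw [← Finset.sum_range_reflect]
    refine Finset.sum_congr rfl fun q hq => ?_
    have hq' : q ≤ N := Nat.lt_succ_iff.1 (Finset.mem_range.1 hq)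
    have e1 : N - (N + 1 - 1 - q) = q := by omega
    have e2 : N + 1 - 1 - q = N - q := by omega
    rw [e1, e2]
  rw [two_mul]
  nth_rewrite 2 [← hrefl]
  rw [← Finset.sum_add_distrib]
  refine (Finset.sum_le_sum (g := fun _ => LinearMap.trace ℝ E (A ^ N * H * H)
    + LinearMap.trace ℝ E (B ^ N * H * H)) fun q hq => ?_).trans (le_of_eq ?_)
  · have hq' : q + (N - q) = N := by have := Finset.mem_range.1 hq; omega
    have := hA.trace_pow_mul_pow_add_le hB hH (q := q) (k := N - q) (by rwa [hq'])
    rwa [hq'] at this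
  · rw [Finset.sum_const, Finset.card_range, nsmul_eq_mul, Nat.cast_add_one]

theorem trace_pow_mul_sq_le {A H : E →ₗ[ℝ] E} (hA : A.IsSymmetric) (hH : H.IsSymmetric) {N : ℕ}
    (hN : Even N) {c : ℝ} (hc : ∀ v, ‖H v‖ ≤ c * ‖v‖) :
    LinearMap.trace ℝ E (A ^ N * H * H) ≤ c ^ 2 * LinearMap.trace ℝ E (A ^ N) := by
  rw [hA.trace_pow rfl, LinearMap.trace_eq_sum_inner _ (hA.eigenvectorBasis rfl), Finset.mul_sum]
  refine Finset.sum_le_sum fun i _ => ?_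
  simp only [Module.End.mul_apply]
  rw [← (hA.pow N), hA.pow_apply_eigenvectorBasis, inner_smul_left, ← hH,
    real_inner_self_eq_norm_sq, conj_trivial, mul_comm]
  refine mul_le_mul_of_nonneg_right ?_ (hN.pow_nonneg _)
  have := hc (hA.eigenvectorBasis rfl i)
  rw [(hA.eigenvectorBasis rfl).norm_eq_one, mul_one] at this
  exact pow_le_pow_left₀ (norm_nonneg _) this 2

end LinearMap.IsSymmetric

theorem pow_succ_sub_pow_succ_eq_sum {R : Type*} [Ring R] (A B : R) (N : ℕ) :
    A ^ (N + 1) - B ^ (N + 1) = ∑ q ∈ Finset.range (N + 1), A ^ q * (A - B) * B ^ (N - q) := by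
  induction N with
  | zero => simp
  | succ N ih =>
    rw [Finset.sum_range_succ]
    have e : ∑ q ∈ Finset.range (N + 1), A ^ q * (A - B) * B ^ (N + 1 - q)
        = (∑ q ∈ Finset.range (N + 1), A ^ q * (A - B) * B ^ (N - q)) * B := by
      rw [Finset.sum_mul]
      refine Finset.sum_congr rfl fun q hq => ?_
      have : N + 1 - q = N - q + 1 := by have := Finset.mem_range.1 hq; omega
      rw [this, pow_succ]
      simp only [mul_assoc]
    rw [e, ← ih, Nat.sub_self, pow_zero, mul_one, pow_succ A (N + 1), pow_succ B (N + 1)]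
    noncomm_ring

/-- The sign of a coin flip. -/
def coinSign (b : Bool) : ℝ := if b then 1 else -1

theorem coinSign_not (b : Bool) : coinSign (!b) = -coinSign b := by
  cases b <;> simp [coinSign]

theorem coinSign_mul_self (b : Bool) : coinSign b * coinSign b = 1 := by
  cases b <;> simp [coinSign]

/-- The signed sum of a family. -/
def signedSum {ι : Type*} [Fintype ι] {V : Type*} [AddCommGroup V] [Module ℝ V] (H : ι → V) (σ : ι → Bool) : V :=
  ∑ i, coinSign (σ i) • H i

theorem signedSum_isSymmetric {ι E : Type*} [Fintype ι] [NormedAddCommGroup E]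
    [InnerProductSpace ℝ E] {H : ι → E →ₗ[ℝ] E} (hH : ∀ i, (H i).IsSymmetric) (σ : ι → Bool) :
    (signedSum H σ).IsSymmetric := by
  intro x y
  simp [signedSum, LinearMap.sum_apply, sum_inner, inner_sum, inner_smul_left, inner_smul_right,
    (hH _) x y]

/-- Flipping one coin. -/
def flipCoin {ι : Type*} [DecidableEq ι] (i : ι) : Equiv.Perm (ι → Bool) :=
  Function.Involutive.toPerm (fun σ => Function.update σ i (!σ i)) fun σ => by simp

theorem flipCoin_apply {ι : Type*} [DecidableEq ι] (i : ι) (σ : ι → Bool) :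
    flipCoin i σ = Function.update σ i (!σ i) := rfl

/-! ### Even moments of signed sums -/

variable {ι : Type*} [Fintype ι] [DecidableEq ι]

theorem signedSum_sub_flipCoin {V : Type*} [AddCommGroup V] [Module ℝ V] (H : ι → V)
    (σ : ι → Bool) (i : ι) :
    signedSum H σ - signedSum H (flipCoin i σ) = (2 * coinSign (σ i)) • H i := by
  rw [signedSum, signedSum, ← Finset.sum_sub_distrib, Finset.sum_eq_single i]
  · simp [flipCoin_apply, coinSign_not, two_mul, add_smul]
  · intro j _ hj
    simp [flipCoin_apply, hj]
  · simp

/-- A discrete integration by parts. Pairing `σ` with its flip at `i` turns the signed traces into a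
difference of powers of two signed sums that differ by `2 σ_i H_i`. Telescoping this difference
leaves mixed words, bounded by `sum_trace_pow_mul_pow_le`. -/
theorem sum_sign_trace_le {H : ι → E →ₗ[ℝ] E} (hH : ∀ i, (H i).IsSymmetric) {N : ℕ}
    (hN : Even N) (i : ι) :
    ∑ σ, coinSign (σ i) * LinearMap.trace ℝ E (signedSum H σ ^ (N + 1) * H i) ≤
      (N + 1) * ∑ σ, LinearMap.trace ℝ E (signedSum H σ ^ N * H i * H i) := by
  set f : (ι → Bool) → ℝ :=
    fun σ => coinSign (σ i) * LinearMap.trace ℝ E (signedSum H σ ^ (N + 1) * H i)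
  set h : (ι → Bool) → ℝ := fun σ => LinearMap.trace ℝ E (signedSum H σ ^ N * H i * H i)
  have hf : ∑ σ, f (flipCoin i σ) = ∑ σ, f σ := Equiv.sum_comp (flipCoin i) f
  have hh : ∑ σ, h (flipCoin i σ) = ∑ σ, h σ := Equiv.sum_comp (flipCoin i) h
  have key : ∀ σ, f σ + f (flipCoin i σ) ≤ (N + 1) * (h σ + h (flipCoin i σ)) := by
    intro σ
    have hs : coinSign (flipCoin i σ i) = -coinSign (σ i) := by simp [flipCoin_apply, coinSign_not]
    have e : f σ + f (flipCoin i σ) = 2 * ∑ q ∈ Finset.range (N + 1), LinearMap.trace ℝ E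
        (signedSum H σ ^ q * H i * signedSum H (flipCoin i σ) ^ (N - q) * H i) := by
      simp only [f]
      rw [hs, neg_mul, ← sub_eq_add_neg, ← mul_sub, ← map_sub, ← sub_mul,
        pow_succ_sub_pow_succ_eq_sum, signedSum_sub_flipCoin, Finset.sum_mul, map_sum,
        Finset.mul_sum, Finset.mul_sum]
      refine Finset.sum_congr rfl fun q _ => ?_
      simp only [mul_smul_comm, smul_mul_assoc, map_smul, smul_eq_mul]
      rw [← mul_assoc, mul_left_comm, coinSign_mul_self, mul_one]
    rw [e]
    exact (signedSum_isSymmetric hH σ).sum_trace_pow_mul_pow_le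
      (signedSum_isSymmetric hH (flipCoin i σ)) (hH i) hN
  have := Finset.sum_le_sum fun σ (_ : σ ∈ Finset.univ) => key σ
  rw [← Finset.mul_sum, Finset.sum_add_distrib, Finset.sum_add_distrib, hf, hh] at this
  linarith

/-- The recursion of Gaussian moments: one factor of the power is expanded into its summands, and
integration by parts is applied to each. -/
theorem sum_trace_signedSum_pow_succ_le {H : ι → E →ₗ[ℝ] E} (hH : ∀ i, (H i).IsSymmetric)
    {c : ι → ℝ} (hc : ∀ i v, ‖H i v‖ ≤ c i * ‖v‖) {N : ℕ} (hN : Even N) :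
    ∑ σ, LinearMap.trace ℝ E (signedSum H σ ^ (N + 2)) ≤
      (N + 1) * (∑ i, c i ^ 2) * ∑ σ, LinearMap.trace ℝ E (signedSum H σ ^ N) := by
  have e : ∀ σ, LinearMap.trace ℝ E (signedSum H σ ^ (N + 2)) =
      ∑ i, coinSign (σ i) * LinearMap.trace ℝ E (signedSum H σ ^ (N + 1) * H i) := by
    intro σ
    rw [pow_succ]
    nth_rewrite 2 [signedSum]
    rw [Finset.mul_sum, map_sum]
    simp only [mul_smul_comm, map_smul, smul_eq_mul]
  simp only [e]
  rw [Finset.sum_comm, mul_assoc, Finset.sum_mul, Finset.mul_sum]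
  refine Finset.sum_le_sum fun i _ => (sum_sign_trace_le hH hN i).trans ?_
  refine mul_le_mul_of_nonneg_left ?_ (by positivity)
  rw [Finset.mul_sum]
  exact Finset.sum_le_sum fun σ _ =>
    (signedSum_isSymmetric hH σ).trace_pow_mul_sq_le (hH i) hN (hc i)

/-- Keeps the product of the recursion factors `1 · 3 ⋯ (2p - 1)` below `p ^ p`; it comes from
Bernoulli's `(1 + 1/p)^p ≥ 2`. -/
theorem two_mul_add_one_mul_pow_le (p : ℕ) : (2 * (p : ℝ) + 1) * p ^ p ≤ (p + 1 : ℝ) ^ (p + 1) := by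
  rcases Nat.eq_zero_or_pos p with rfl | hp
  · simp
  have hp' : (0 : ℝ) < p := by exact_mod_cast hp
  have h := one_add_mul_le_pow (a := 1 / (p : ℝ)) (by have : 0 ≤ 1 / (p : ℝ) := by positivity
                                                      linarith) p
  have e : (p + 1 : ℝ) ^ p = (1 + 1 / (p : ℝ)) ^ p * p ^ p := by
    rw [← mul_pow]
    congr 1
    field_simp
  rw [mul_one_div_cancel hp'.ne'] at h
  have h2 : 2 * (p : ℝ) ^ p ≤ (p + 1 : ℝ) ^ p := by
    rw [e]
    exact mul_le_mul_of_nonneg_right (by linarith) (by positivity)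
  rw [pow_succ]
  have : (0 : ℝ) ≤ (p : ℝ) ^ p := by positivity
  nlinarith

theorem sum_trace_signedSum_pow_le {H : ι → E →ₗ[ℝ] E} (hH : ∀ i, (H i).IsSymmetric)
    {c : ι → ℝ} (hc : ∀ i v, ‖H i v‖ ≤ c i * ‖v‖) (p : ℕ) :
    ∑ σ, LinearMap.trace ℝ E (signedSum H σ ^ (2 * p)) ≤
      (p : ℝ) ^ p * (∑ i, c i ^ 2) ^ p * (Fintype.card (ι → Bool) * Module.finrank ℝ E) := by
  induction p with
  | zero => simp
  | succ p ih =>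
    have hV : 0 ≤ ∑ i, c i ^ 2 := Finset.sum_nonneg fun i _ => sq_nonneg _
    have := sum_trace_signedSum_pow_succ_le hH hc (even_two_mul p)
    rw [mul_add_one]
    refine this.trans ?_
    calc _ ≤ (((2 * p : ℕ) : ℝ) + 1) * (∑ i, c i ^ 2) * ((p : ℝ) ^ p * (∑ i, c i ^ 2) ^ p
          * (Fintype.card (ι → Bool) * Module.finrank ℝ E)) := by gcongr
      _ = ((2 * (p : ℝ) + 1) * p ^ p) * ((∑ i, c i ^ 2) ^ (p + 1)
          * (Fintype.card (ι → Bool) * Module.finrank ℝ E)) := by push_cast; ring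
      _ ≤ (p + 1 : ℝ) ^ (p + 1) * ((∑ i, c i ^ 2) ^ (p + 1)
          * (Fintype.card (ι → Bool) * Module.finrank ℝ E)) := by
          gcongr
          exact two_mul_add_one_mul_pow_le p
      _ = _ := by push_cast; ring

theorem opNorm_sq_pow_le_trace {A : E →L[ℝ] E} (hA : (A : E →ₗ[ℝ] E).IsSymmetric) {p : ℕ}
    (hp : p ≠ 0) : (‖A‖ ^ 2) ^ p ≤ LinearMap.trace ℝ E ((A : E →ₗ[ℝ] E) ^ (2 * p)) := by
  have hn : Module.finrank ℝ E = Module.finrank ℝ E := rfl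
  have htr := hA.trace_pow hn (2 * p)
  set M := LinearMap.trace ℝ E ((A : E →ₗ[ℝ] E) ^ (2 * p))
  have hnn : ∀ i, 0 ≤ hA.eigenvalues hn i ^ (2 * p) := fun i => (even_two_mul p).pow_nonneg _
  have hM : 0 ≤ M := by rw [htr]; exact Finset.sum_nonneg fun i _ => hnn i
  set s := M ^ ((p : ℝ)⁻¹)
  have hs : 0 ≤ s := Real.rpow_nonneg hM _
  have hsp : s ^ p = M := Real.rpow_inv_natCast_pow hM hp
  have hlam : ∀ i, hA.eigenvalues hn i ^ 2 ≤ s := by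
    intro i
    rw [← pow_le_pow_iff_left₀ (sq_nonneg _) hs hp, hsp, ← pow_mul, htr]
    exact Finset.single_le_sum (f := fun i => hA.eigenvalues hn i ^ (2 * p))
      (fun i _ => hnn i) (Finset.mem_univ i)
  have hbound : ‖A‖ ≤ √s := by
    refine A.opNorm_le_bound (Real.sqrt_nonneg _) fun v => ?_
    refine le_of_sq_le_sq ?_ (by positivity)
    rw [mul_pow, Real.sq_sqrt hs]
    have e : ‖A v‖ ^ 2 = inner ℝ v (((A : E →ₗ[ℝ] E) ^ 2) v) := by
      rw [← real_inner_self_eq_norm_sq, pow_two, Module.End.mul_apply]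
      exact hA v (A v)
    rw [e, hA.inner_pow_apply_self hn]
    have e2 : ‖v‖ ^ 2 = ∑ i, inner ℝ (hA.eigenvectorBasis hn i) v ^ 2 := by
      have := (hA.eigenvectorBasis hn).sum_sq_norm_inner_right v
      simpa using this.symm
    rw [e2, Finset.mul_sum]
    exact Finset.sum_le_sum fun i _ => mul_le_mul_of_nonneg_right (hlam i) (sq_nonneg _)
  have h2 : ‖A‖ ^ 2 ≤ s := by
    calc ‖A‖ ^ 2 ≤ √s ^ 2 := by gcongr
      _ = s := Real.sq_sqrt hs
  calc (‖A‖ ^ 2) ^ p ≤ s ^ p := by gcongr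
    _ = M := hsp

/-- Jensen's inequality passes to the moment of order `2p`, where the norm is dominated by a trace.
The price is the factor `finrank`, to be removed by a `p`-th root. -/
theorem mean_norm_signedSum_sq_pow_le {H : ι → E →L[ℝ] E}
    (hH : ∀ i, (H i : E →ₗ[ℝ] E).IsSymmetric) {p : ℕ} (hp : p ≠ 0) :
    ((Fintype.card (ι → Bool) : ℝ)⁻¹ * ∑ σ, ‖signedSum H σ‖ ^ 2) ^ p ≤
      Module.finrank ℝ E * (p * ∑ i, ‖H i‖ ^ 2) ^ p := by
  set K : ℝ := (Fintype.card (ι → Bool) : ℝ) with hK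
  have hK0 : 0 < K := by rw [hK]; exact_mod_cast Fintype.card_pos
  have hcoe : ∀ σ, ((signedSum H σ : E →L[ℝ] E) : E →ₗ[ℝ] E)
      = signedSum (fun i => (H i : E →ₗ[ℝ] E)) σ := by
    intro σ
    ext x
    simp [signedSum, LinearMap.sum_apply]
  have hjensen := Real.pow_arith_mean_le_arith_mean_pow (Finset.univ : Finset (ι → Bool))
    (fun _ => K⁻¹) (fun σ => ‖signedSum H σ‖ ^ 2) (fun _ _ => by positivity)
    (by simp [hK]) (fun _ _ => by positivity) p
  rw [← Finset.mul_sum, ← Finset.mul_sum] at hjensen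
  refine hjensen.trans ?_
  have h1 : ∑ σ, (‖signedSum H σ‖ ^ 2) ^ p ≤
      (p : ℝ) ^ p * (∑ i, ‖H i‖ ^ 2) ^ p * (K * Module.finrank ℝ E) := by
    refine (Finset.sum_le_sum fun σ _ => ?_).trans
      (sum_trace_signedSum_pow_le hH (fun i v => (H i).le_opNorm v) p)
    rw [← hcoe]
    exact opNorm_sq_pow_le_trace (by rw [hcoe]; exact signedSum_isSymmetric hH σ) hp
  calc K⁻¹ * ∑ σ, (‖signedSum H σ‖ ^ 2) ^ p
      ≤ K⁻¹ * ((p : ℝ) ^ p * (∑ i, ‖H i‖ ^ 2) ^ p * (K * Module.finrank ℝ E)) := by gcongr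
    _ = _ := by rw [mul_pow]; field_simp

/-- Khintchine inequality for symmetric operators: the second moment of the spectral norm. -/
theorem mean_norm_signedSum_sq_le {n : ℕ} (hn : 2 ≤ n) (hE : Module.finrank ℝ E = n)
    {H : ι → E →L[ℝ] E} (hH : ∀ i, (H i : E →ₗ[ℝ] E).IsSymmetric) :
    (Fintype.card (ι → Bool) : ℝ)⁻¹ * ∑ σ, ‖signedSum H σ‖ ^ 2 ≤
      11 / 2 * Real.log n * ∑ i, ‖H i‖ ^ 2 := by
  have hV : 0 ≤ ∑ i, ‖H i‖ ^ 2 := Finset.sum_nonneg fun i _ => sq_nonneg _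
  rcases hn.eq_or_lt with rfl | hn3
  -- For `n = 2` the choice `p = 1` gives the factor `2`, which is below `(11/2) log 2`.
  · have := mean_norm_signedSum_sq_pow_le hH one_ne_zero
    rw [hE, pow_one, pow_one, Nat.cast_one, one_mul] at this
    refine this.trans (mul_le_mul_of_nonneg_right ?_ hV)
    have := Real.log_two_gt_d9
    norm_num at this ⊢
    linarith
  · have hn0 : (0 : ℝ) < n := by positivity
    have hlog : 1 < Real.log n := by
      rw [Real.lt_log_iff_exp_lt hn0]
      have : (3 : ℝ) ≤ n := by exact_mod_cast hn3
      linarith [Real.exp_one_lt_d9]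
    -- With this `p` one has `n ≤ e^p`, so the `p`-th root of the dimension costs at most `e`. As
    -- `log n > 1`, also `p ≤ 2 log n`, and `2e < 11/2`.
    set p := ⌈Real.log n⌉₊ with hp
    have hp0 : p ≠ 0 := (Nat.ceil_pos.2 (by linarith)).ne'
    have hple : (p : ℝ) ≤ 2 * Real.log n := by
      have := Nat.ceil_lt_add_one (show 0 ≤ Real.log n by linarith)
      linarith
    have hexp : (n : ℝ) ≤ Real.exp 1 ^ p := by
      rw [← Real.exp_nat_mul, mul_one, ← Real.log_le_iff_le_exp hn0]
      exact Nat.le_ceil _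
    have h1 := mean_norm_signedSum_sq_pow_le hH hp0
    rw [hE] at h1
    have h2 : ((Fintype.card (ι → Bool) : ℝ)⁻¹ * ∑ σ, ‖signedSum H σ‖ ^ 2) ^ p
        ≤ (Real.exp 1 * (p * ∑ i, ‖H i‖ ^ 2)) ^ p := by
      rw [mul_pow (Real.exp 1)]
      exact h1.trans (by gcongr)
    have h3 := le_of_pow_le_pow_left₀ hp0 (by positivity) h2
    refine h3.trans ?_
    rw [← mul_assoc]
    refine mul_le_mul_of_nonneg_right ?_ hV
    have he := Real.exp_one_lt_d9
    have he0 := Real.exp_pos 1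
    calc Real.exp 1 * p ≤ Real.exp 1 * (2 * Real.log n) := by gcongr
      _ ≤ 2.7182818286 * (2 * Real.log n) := by gcongr
      _ ≤ _ := by nlinarith

end Khintchine

/-! ### Sums of independent centred vectors and operators -/

section BatchVariance

variable {Ξ : Type*} [MeasurableSpace Ξ] {D : Measure Ξ} [IsProbabilityMeasure D]
  {ι : Type*} [Fintype ι]

theorem sq_norm_integral_le {V Ω : Type*} [NormedAddCommGroup V] [NormedSpace ℝ V]
    [MeasurableSpace Ω] {μ : Measure Ω} [IsProbabilityMeasure μ] {f : Ω → V} (hf : MemLp f 2 μ) :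
    ‖∫ ω, f ω ∂μ‖ ^ 2 ≤ ∫ ω, ‖f ω‖ ^ 2 ∂μ := by
  have h1 : (∫ ω, ‖f ω‖ ∂μ) ^ 2 ≤ ∫ ω, ‖f ω‖ ^ 2 ∂μ := by
    have := variance_nonneg (fun ω => ‖f ω‖) μ
    rw [variance_eq_sub hf.norm] at this
    simpa using this
  exact (pow_le_pow_left₀ (norm_nonneg _) (norm_integral_le_integral_norm f) 2).trans h1

theorem MeasureTheory.MemLp.sum_eval {V : Type*} [NormedAddCommGroup V] {p : ENNReal} {Y : Ξ → V}
    (hY : MemLp Y p D) : MemLp (fun s : ι → Ξ => ∑ i, Y (s i)) p (Measure.pi fun _ => D) :=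
  memLp_finsetSum _ fun i _ =>
    hY.comp_measurePreserving (measurePreserving_eval (fun _ : ι => D) i)

theorem integral_sum_eval {V : Type*} [NormedAddCommGroup V] [NormedSpace ℝ V] {Y : Ξ → V}
    (hY : Integrable Y D) :
    ∫ s : ι → Ξ, ∑ i, Y (s i) ∂(Measure.pi fun _ => D) = Fintype.card ι • ∫ ξ, Y ξ ∂D := by
  rw [integral_finsetSum _ fun i _ => integrable_comp_eval hY]
  simp [integral_comp_eval (μ := fun _ : ι => D) hY.aestronglyMeasurable]

/-- The second moment of a sum of independent centred vectors. -/
theorem integral_norm_sq_sum_eval {V : Type*} [NormedAddCommGroup V] [InnerProductSpace ℝ V]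
    [CompleteSpace V] [MeasurableSpace V] [BorelSpace V] {Y : Ξ → V} (hY : MemLp Y 2 D)
    (hY0 : ∫ ξ, Y ξ ∂D = 0) :
    ∫ s : ι → Ξ, ‖∑ i, Y (s i)‖ ^ 2 ∂(Measure.pi fun _ => D) =
      Fintype.card ι * ∫ ξ, ‖Y ξ‖ ^ 2 ∂D := by
  classical
  have hmem : ∀ i : ι, MemLp (fun s : ι → Ξ => Y (s i)) 2 (Measure.pi fun _ => D) := fun i =>
    hY.comp_measurePreserving (measurePreserving_eval (fun _ : ι => D) i)
  have hint1 : Integrable Y D := hY.integrable (by norm_num)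
  have hcross : ∀ i j : ι, i ≠ j →
      ∫ s : ι → Ξ, inner ℝ (Y (s i)) (Y (s j)) ∂(Measure.pi fun _ => D) = 0 := by
    intro i j hij
    have hind := (iIndepFun_pi (μ := fun _ : ι => D) (X := fun _ => Y)
      (fun _ => hint1.aestronglyMeasurable.aemeasurable)).indepFun hij
    have := hind.integral_bilin ((hmem i).integrable (by norm_num))
      ((hmem j).integrable (by norm_num)) (innerSL ℝ : V →L[ℝ] V →L[ℝ] ℝ)
    refine this.trans ?_
    rw [integral_comp_eval (μ := fun _ : ι => D) (i := i) hint1.aestronglyMeasurable, hY0]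
    simp
  have hexp : ∀ s : ι → Ξ, ‖∑ i, Y (s i)‖ ^ 2 = ∑ i, ∑ j, inner ℝ (Y (s i)) (Y (s j)) := by
    intro s
    rw [← real_inner_self_eq_norm_sq, sum_inner]
    simp only [inner_sum]
  simp only [hexp]
  have hint : ∀ i j : ι, Integrable (fun s : ι → Ξ => inner ℝ (Y (s i)) (Y (s j)))
      (Measure.pi fun _ => D) := by
    intro i j
    refine (((hmem i).integrable_norm_pow (p := 2) (by norm_num)).add
      ((hmem j).integrable_norm_pow (p := 2) (by norm_num))).mono'
      ((hmem i).aestronglyMeasurable.inner (hmem j).aestronglyMeasurable)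
      (Filter.Eventually.of_forall fun s => ?_)
    refine (norm_inner_le_norm _ _).trans ?_
    simp only [Pi.add_apply]
    nlinarith [sq_nonneg (‖Y (s i)‖ - ‖Y (s j)‖), sq_nonneg ‖Y (s i)‖, sq_nonneg ‖Y (s j)‖]
  rw [integral_finsetSum _ fun i _ => integrable_finsetSum _ fun j _ => hint i j]
  have : ∀ i : ι, ∫ s : ι → Ξ, ∑ j, inner ℝ (Y (s i)) (Y (s j)) ∂(Measure.pi fun _ => D)
      = ∫ ξ, ‖Y ξ‖ ^ 2 ∂D := by
    intro i
    rw [integral_finsetSum _ fun j _ => hint i j, Finset.sum_eq_single i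
      (fun j _ hj => hcross i j hj.symm) (by simp)]
    simp only [real_inner_self_eq_norm_sq]
    exact integral_comp_eval (μ := fun _ : ι => D) (i := i) (f := fun ξ => ‖Y ξ‖ ^ 2)
      (hY.integrable_norm_pow (by norm_num)).aestronglyMeasurable
  simp [this]

/-- Symmetrization by independent copies. -/
theorem integral_norm_sq_sum_eval_le_pairs {V : Type*} [NormedAddCommGroup V] [NormedSpace ℝ V]
    [CompleteSpace V] {A : Ξ → V} (hA : MemLp A 2 D) (hA0 : ∫ ξ, A ξ ∂D = 0) :
    ∫ s : ι → Ξ, ‖∑ i, A (s i)‖ ^ 2 ∂(Measure.pi fun _ => D) ≤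
      ∫ w : ι → Ξ × Ξ, ‖∑ i, (A (w i).1 - A (w i).2)‖ ^ 2 ∂(Measure.pi fun _ => D.prod D) := by
  set μ : Measure (ι → Ξ) := Measure.pi fun _ => D
  set S : (ι → Ξ) → V := fun s => ∑ i, A (s i) with hS
  have hSm : MemLp S 2 μ := hA.sum_eval
  have hS0 : ∫ s, S s ∂μ = 0 := by
    rw [hS, integral_sum_eval (hA.integrable (by norm_num)), hA0, smul_zero]
  have hSint : Integrable S μ := hSm.integrable (by norm_num)
  -- Jensen's inequality in the independent copy, whose sum has mean zero.
  have hpoint : ∀ s, ‖S s‖ ^ 2 ≤ ∫ s', ‖S s - S s'‖ ^ 2 ∂μ := by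
    intro s
    have h := sq_norm_integral_le (f := fun s' => S s - S s') ((memLp_const (S s)).sub hSm)
    rw [integral_sub (integrable_const _) hSint, hS0, sub_zero, integral_const] at h
    simpa using h
  have hdiff : MemLp (fun p : (ι → Ξ) × (ι → Ξ) => S p.1 - S p.2) 2 (μ.prod μ) :=
    (hSm.comp_measurePreserving measurePreserving_fst).sub
      (hSm.comp_measurePreserving measurePreserving_snd)
  have hdiff2 := hdiff.integrable_norm_pow (p := 2) (by norm_num)
  calc ∫ s, ‖S s‖ ^ 2 ∂μ ≤ ∫ s, ∫ s', ‖S s - S s'‖ ^ 2 ∂μ ∂μ :=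
        integral_mono (hSm.integrable_norm_pow (by norm_num)) hdiff2.integral_prod_left hpoint
    _ = ∫ p, ‖S p.1 - S p.2‖ ^ 2 ∂(μ.prod μ) := (integral_prod _ hdiff2).symm
    _ = _ := by
        rw [← (measurePreserving_arrowProdEquivProdArrow Ξ Ξ ι (fun _ => D)
          (fun _ => D)).integral_comp']
        refine integral_congr_ae (Filter.Eventually.of_forall fun w => ?_)
        simp only [hS, Finset.sum_sub_distrib]
        rfl

/-- Exchanging the two members of a pair preserves `D.prod D` and changes the sign of the
difference. -/
theorem integral_pairs_eq_signedSum {V : Type*} [NormedAddCommGroup V] [NormedSpace ℝ V]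
    {A : Ξ → V} (σ : ι → Bool) :
    ∫ w : ι → Ξ × Ξ, ‖∑ i, (A (w i).1 - A (w i).2)‖ ^ 2 ∂(Measure.pi fun _ => D.prod D) =
      ∫ w : ι → Ξ × Ξ, ‖signedSum (fun i => A (w i).1 - A (w i).2) σ‖ ^ 2
        ∂(Measure.pi fun _ => D.prod D) := by
  let e : ι → Ξ × Ξ ≃ᵐ Ξ × Ξ := fun i =>
    if σ i then MeasurableEquiv.refl _ else MeasurableEquiv.prodComm
  have he : ∀ i, MeasurePreserving (e i) (D.prod D) (D.prod D) := by
    intro i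
    simp only [e]
    split
    · exact MeasurePreserving.id _
    · exact Measure.measurePreserving_swap
  have hpi := measurePreserving_pi (fun _ : ι => D.prod D) (fun _ : ι => D.prod D) he
  have hemb : MeasurableEmbedding fun (w : ι → Ξ × Ξ) i => e i (w i) :=
    (MeasurableEquiv.piCongrRight e).measurableEmbedding
  rw [← hpi.integral_comp hemb]
  refine integral_congr_ae (Filter.Eventually.of_forall fun w => ?_)
  simp only [signedSum]
  congr 2
  refine Finset.sum_congr rfl fun i _ => ?_
  by_cases h : σ i = true
  · simp [e, h, coinSign]
  · simp only [e, h, coinSign, Bool.false_eq_true, if_false, neg_one_smul, neg_sub]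
    rfl

/-- The second moment of the spectral norm of a sum of independent centred symmetric operators. -/
theorem integral_opNorm_sq_sum_eval_le {E : Type*} [NormedAddCommGroup E] [InnerProductSpace ℝ E]
    [FiniteDimensional ℝ E] {n : ℕ} (hn : 2 ≤ n) (hE : Module.finrank ℝ E = n)
    {A : Ξ → E →L[ℝ] E} (hA : MemLp A 2 D) (hA0 : ∫ ξ, A ξ ∂D = 0)
    (hsymm : ∀ ξ, (A ξ : E →ₗ[ℝ] E).IsSymmetric) :
    ∫ s : ι → Ξ, ‖∑ i, A (s i)‖ ^ 2 ∂(Measure.pi fun _ => D) ≤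
      22 * Real.log n * (Fintype.card ι * ∫ ξ, ‖A ξ‖ ^ 2 ∂D) := by
  classical
  set B : Ξ × Ξ → E →L[ℝ] E := fun z => A z.1 - A z.2 with hB
  set ν : Measure (ι → Ξ × Ξ) := Measure.pi fun _ => D.prod D
  have hBm : MemLp B 2 (D.prod D) :=
    (hA.comp_measurePreserving measurePreserving_fst).sub
      (hA.comp_measurePreserving measurePreserving_snd)
  have hBi : ∀ i : ι, MemLp (fun w : ι → Ξ × Ξ => B (w i)) 2 ν := fun i =>
    hBm.comp_measurePreserving (measurePreserving_eval (fun _ : ι => D.prod D) i)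
  have hBs : ∀ z, (B z : E →ₗ[ℝ] E).IsSymmetric := by
    intro z x y
    have h1 := hsymm z.1 x y
    have h2 := hsymm z.2 x y
    simp only [ContinuousLinearMap.coe_coe] at h1 h2 ⊢
    simp only [hB, _root_.sub_apply, inner_sub_left, inner_sub_right, h1, h2]
  have hsigned : ∀ σ : ι → Bool,
      Integrable (fun w => ‖signedSum (fun i => B (w i)) σ‖ ^ 2) ν := fun σ =>
    (memLp_finsetSum Finset.univ fun i _ => (hBi i).const_smul (coinSign (σ i))).integrable_norm_pow
      (by norm_num)
  have hA2 : Integrable (fun ξ => ‖A ξ‖ ^ 2) D := hA.integrable_norm_pow (by norm_num)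
  have hB2 : ∫ z, ‖B z‖ ^ 2 ∂(D.prod D) ≤ 4 * ∫ ξ, ‖A ξ‖ ^ 2 ∂D := by
    have hf : Integrable (fun z : Ξ × Ξ => ‖A z.1‖ ^ 2) (D.prod D) := hA2.comp_fst _
    have hs : Integrable (fun z : Ξ × Ξ => ‖A z.2‖ ^ 2) (D.prod D) := hA2.comp_snd _
    calc ∫ z, ‖B z‖ ^ 2 ∂(D.prod D)
        ≤ ∫ z : Ξ × Ξ, (2 * ‖A z.1‖ ^ 2 + 2 * ‖A z.2‖ ^ 2) ∂(D.prod D) := by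
          refine integral_mono (hBm.integrable_norm_pow (by norm_num))
            ((hf.const_mul 2).add (hs.const_mul 2)) fun z => ?_
          have h1 := norm_sub_le (A z.1) (A z.2)
          have h2 := norm_nonneg (A z.1 - A z.2)
          simp only [hB]
          nlinarith [sq_nonneg (‖A z.1‖ - ‖A z.2‖)]
      _ = _ := by
          rw [integral_add (hf.const_mul 2) (hs.const_mul 2), integral_const_mul,
            integral_const_mul, integral_fun_fst (fun ξ => ‖A ξ‖ ^ 2),
            integral_fun_snd (fun ξ => ‖A ξ‖ ^ 2)]
          simp
          ring
  have hlog : 0 ≤ Real.log n := Real.log_natCast_nonneg n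
  have hKpos : (Fintype.card (ι → Bool) : ℝ) ≠ 0 := by exact_mod_cast Fintype.card_ne_zero
  refine (integral_norm_sq_sum_eval_le_pairs hA hA0).trans ?_
  set I := ∫ w : ι → Ξ × Ξ, ‖∑ i, (A (w i).1 - A (w i).2)‖ ^ 2 ∂ν with hI
  have hIσ : ∀ σ : ι → Bool, ∫ w, ‖signedSum (fun i => B (w i)) σ‖ ^ 2 ∂ν = I := fun σ =>
    (integral_pairs_eq_signedSum σ).symm
  -- The integral is the same for every sign pattern, hence equals its average over patterns, to
  -- which Khintchine applies for fixed `w`. Together with the factor `4` of `hB2` this gives `22 =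
  -- 4 · 11/2`.
  have hmean : I = ∫ w, (Fintype.card (ι → Bool) : ℝ)⁻¹ *
      ∑ σ, ‖signedSum (fun i => B (w i)) σ‖ ^ 2 ∂ν := by
    rw [integral_const_mul, integral_finsetSum _ fun σ _ => hsigned σ]
    simp only [hIσ, Finset.sum_const, Finset.card_univ, nsmul_eq_mul]
    rw [inv_mul_cancel_left₀ hKpos]
  have hBi2 : ∀ i : ι, Integrable (fun w : ι → Ξ × Ξ => ‖B (w i)‖ ^ 2) ν := fun i =>
    (hBi i).integrable_norm_pow (by norm_num)
  calc I ≤ ∫ w, 11 / 2 * Real.log n * ∑ i, ‖B (w i)‖ ^ 2 ∂ν := by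
        rw [hmean]
        refine integral_mono ((integrable_finsetSum _ fun σ _ => hsigned σ).const_mul _)
          ((integrable_finsetSum _ fun i _ => hBi2 i).const_mul _) fun w => ?_
        exact mean_norm_signedSum_sq_le hn hE fun i => hBs (w i)
    _ = 11 / 2 * Real.log n * (Fintype.card ι * ∫ z, ‖B z‖ ^ 2 ∂(D.prod D)) := by
        rw [integral_const_mul, integral_finsetSum _ fun i _ => hBi2 i]
        congr 1
        have : ∀ i : ι, ∫ w, ‖B (w i)‖ ^ 2 ∂ν = ∫ z, ‖B z‖ ^ 2 ∂(D.prod D) := fun i =>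
          integral_comp_eval (μ := fun _ : ι => D.prod D) (i := i) (f := fun z => ‖B z‖ ^ 2)
            (hBm.integrable_norm_pow (by norm_num)).aestronglyMeasurable
        simp [this]
    _ ≤ 11 / 2 * Real.log n * (Fintype.card ι * (4 * ∫ ξ, ‖A ξ‖ ^ 2 ∂D)) := by gcongr
    _ = _ := by ring

end BatchVariance

/-! ### Derivatives of batch functions and their measurability -/

section Batch

variable {n : ℕ} {Ξ : Type*}

theorem gradient_batch {f : Vec n → Ξ → ℝ} (hf : ∀ ξ, Differentiable ℝ fun x => f x ξ) {m : ℕ}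
    (S : Fin m → Ξ) (x : Vec n) :
    gradient (batch f S) x = (1 / (m : ℝ)) • ∑ i, gradient (fun y => f y (S i)) x := by
  refine ext_inner_right ℝ fun v => ?_
  have h : HasFDerivAt (batch f S)
      ((1 / (m : ℝ)) • ∑ i, fderiv ℝ (fun y => f y (S i)) x) x :=
    (HasFDerivAt.fun_sum fun i _ => ((hf (S i)) x).hasFDerivAt).const_mul _
  rw [inner_gradient_left, h.fderiv, inner_smul_left, sum_inner]
  simp [inner_gradient_left]

theorem hasFDerivAt_gradient_batch {f : Vec n → Ξ → ℝ}
    (hf : ∀ ξ, TwiceDifferentiable fun x => f x ξ) {m : ℕ} (S : Fin m → Ξ) (x : Vec n) :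
    HasFDerivAt (gradient (batch f S))
      ((1 / (m : ℝ)) • ∑ i, hessian (fun y => f y (S i)) x) x := by
  have e : gradient (batch f S) =
      fun x => (1 / (m : ℝ)) • ∑ i, gradient (fun y => f y (S i)) x :=
    funext fun x => gradient_batch (fun ξ => (hf ξ).1) S x
  rw [e]
  exact (HasFDerivAt.fun_sum fun i _ => ((hf (S i)).2 x).hasFDerivAt).const_smul (1 / (m : ℝ))

theorem hessian_batch {f : Vec n → Ξ → ℝ} (hf : ∀ ξ, TwiceDifferentiable fun x => f x ξ) {m : ℕ}
    (S : Fin m → Ξ) (x : Vec n) :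
    hessian (batch f S) x = (1 / (m : ℝ)) • ∑ i, hessian (fun y => f y (S i)) x :=
  (hasFDerivAt_gradient_batch hf S x).fderiv

theorem twiceDifferentiable_batch {f : Vec n → Ξ → ℝ}
    (hf : ∀ ξ, TwiceDifferentiable fun x => f x ξ) {m : ℕ} (S : Fin m → Ξ) :
    TwiceDifferentiable (batch f S) := by
  refine ⟨fun x => ?_, fun x => (hasFDerivAt_gradient_batch hf S x).differentiableAt⟩
  exact ((HasFDerivAt.fun_sum fun i _ =>
    ((hf (S i)).1 x).hasFDerivAt).const_mul _).differentiableAt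

variable [MeasurableSpace Ξ]

/-- A derivative is a limit of difference quotients. These are jointly measurable because `h` is
continuous in one variable and measurable in the other. -/
theorem measurable_fderiv_apply_with_param {V : Type*} [NormedAddCommGroup V] [NormedSpace ℝ V]
    [MeasurableSpace V] [BorelSpace V] [SecondCountableTopology V] {h : Vec n → Ξ → V}
    (hm : ∀ x, Measurable (h x)) (hd : ∀ ξ, Differentiable ℝ fun x => h x ξ) (v : Vec n) :
    Measurable fun p : Vec n × Ξ => fderiv ℝ (fun x => h x p.2) p.1 v := by
  have hjoint : Measurable (Function.uncurry h) :=
    measurable_uncurry_of_continuous_of_measurable (fun ξ => (hd ξ).continuous) hm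
  refine measurable_of_tendsto_metrizable
    (f := fun (k : ℕ) (p : Vec n × Ξ) =>
      (k : ℝ) • (h (p.1 + (k : ℝ)⁻¹ • v) p.2 - h p.1 p.2)) (fun k => ?_) ?_
  · have h1 : Measurable fun p : Vec n × Ξ => h (p.1 + (k : ℝ)⁻¹ • v) p.2 :=
      hjoint.comp ((measurable_fst.add_const _).prodMk measurable_snd)
    have h2 : Measurable fun p : Vec n × Ξ => h p.1 p.2 := hjoint
    exact (h1.sub h2).const_smul (k : ℝ)
  · rw [tendsto_pi_nhds]
    intro p
    refine ((hd p.2) p.1).hasFDerivAt.lim v ?_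
    simpa using tendsto_natCast_atTop_atTop

theorem measurable_gradient_with_param {f : Vec n → Ξ → ℝ} (hm : ∀ x, Measurable (f x))
    (hd : ∀ ξ, Differentiable ℝ fun x => f x ξ) :
    Measurable fun p : Vec n × Ξ => gradient (fun x => f x p.2) p.1 := by
  have e : (fun p : Vec n × Ξ => gradient (fun x => f x p.2) p.1) = fun p =>
      ∑ i, fderiv ℝ (fun x => f x p.2) p.1 (EuclideanSpace.basisFun (Fin n) ℝ i) •
        EuclideanSpace.basisFun (Fin n) ℝ i := by
    funext p
    rw [← (EuclideanSpace.basisFun (Fin n) ℝ).sum_repr' (gradient (fun x => f x p.2) p.1)]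
    refine Finset.sum_congr rfl fun i _ => ?_
    rw [real_inner_comm, inner_gradient_left]
  rw [e]
  exact Finset.measurable_fun_sum _ fun i _ =>
    (measurable_fderiv_apply_with_param hm hd _).smul_const _

theorem measurable_hessian_with_param {f : Vec n → Ξ → ℝ} (hm : ∀ x, Measurable (f x))
    (hd : ∀ ξ, TwiceDifferentiable fun x => f x ξ) :
    Measurable fun p : Vec n × Ξ => hessian (fun x => f x p.2) p.1 := by
  set b := EuclideanSpace.basisFun (Fin n) ℝ
  have hg : ∀ x, Measurable fun ξ => gradient (fun y => f y ξ) x := fun x =>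
    (measurable_gradient_with_param hm fun ξ => (hd ξ).1).comp measurable_prodMk_left
  have hmeas : ∀ i, Measurable fun p : Vec n × Ξ => hessian (fun x => f x p.2) p.1 (b i) :=
    fun i => measurable_fderiv_apply_with_param hg (fun ξ => (hd ξ).2) (b i)
  have e : (fun p : Vec n × Ξ => hessian (fun x => f x p.2) p.1) = fun p =>
      ∑ i, ContinuousLinearMap.smulRightL ℝ (Vec n) (Vec n) (innerSL ℝ (b i))
        (hessian (fun x => f x p.2) p.1 (b i)) := by
    funext p
    refine ContinuousLinearMap.ext fun v => ?_
    conv_lhs => rw [← b.sum_repr' v, map_sum]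
    simp [sum_apply]
  rw [e]
  refine Finset.measurable_fun_sum _ fun i _ => ?_
  exact (ContinuousLinearMap.continuous _).measurable.comp (hmeas i)

theorem measurable_gradient_batch {f : Vec n → Ξ → ℝ} (hf : StochasticComponent f) (m : ℕ) :
    Measurable fun p : Vec n × (Fin m → Ξ) => gradient (batch f p.2) p.1 := by
  simp only [gradient_batch fun ξ => (hf.2 ξ).1]
  have h : Measurable fun p : Vec n × (Fin m → Ξ) => ∑ i, gradient (fun y => f y (p.2 i)) p.1 :=
    Finset.measurable_fun_sum _ fun i _ => (measurable_gradient_with_param hf.1 fun ξ => (hf.2 ξ).1).comp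
      (measurable_fst.prodMk ((measurable_pi_apply i).comp measurable_snd))
  exact h.const_smul (1 / (m : ℝ))

theorem measurable_hessian_batch {f : Vec n → Ξ → ℝ} (hf : StochasticComponent f) (m : ℕ) :
    Measurable fun p : Vec n × (Fin m → Ξ) => hessian (batch f p.2) p.1 := by
  simp only [hessian_batch hf.2]
  have h : Measurable fun p : Vec n × (Fin m → Ξ) => ∑ i, hessian (fun y => f y (p.2 i)) p.1 :=
    Finset.measurable_fun_sum _ fun i _ => (measurable_hessian_with_param hf.1 hf.2).comp
      (measurable_fst.prodMk ((measurable_pi_apply i).comp measurable_snd))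
  exact h.const_smul (1 / (m : ℝ))

end Batch

/-! ### Errors of the batch derivatives at a fixed point -/

section BatchError

variable {n : ℕ} {Ξ : Type*} [MeasurableSpace Ξ] {D : Measure Ξ} [IsProbabilityMeasure D]
  {f : Vec n → Ξ → ℝ} {F : Vec n → ℝ}

theorem integral_norm_le_of_sq {V Ω : Type*} [NormedAddCommGroup V] [MeasurableSpace Ω]
    {μ : Measure Ω} [IsProbabilityMeasure μ] {Z : Ω → V} (hZ : MemLp Z 2 μ) {b : ℝ} (hb : 0 ≤ b)
    (h : ∫ ω, ‖Z ω‖ ^ 2 ∂μ ≤ b ^ 2) : ∫ ω, ‖Z ω‖ ∂μ ≤ b := by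
  have := sq_norm_integral_le hZ.norm
  simp only [norm_norm] at this
  exact (le_abs_self _).trans (abs_le_of_sq_le_sq (by simpa using this.trans h) hb)

theorem integral_norm_gradient_batch_sub_le (hf : StochasticComponent f) {G₀ G₁ : ℝ}
    (hG₀ : 0 ≤ G₀) (hG₁ : 0 ≤ G₁) (hv : GradientVarianceBounded D f F G₀ G₁) {ε : ℝ} (hε : 0 < ε)
    {m : ℕ} (hm : 1 / ε ^ 2 ≤ m) (x : Vec n) :
    Integrable (fun s : Fin m → Ξ => ‖gradient (batch f s) x - gradient F x‖)
      (Measure.pi fun _ => D) ∧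
    ∫ s : Fin m → Ξ, ‖gradient (batch f s) x - gradient F x‖ ∂(Measure.pi fun _ => D) ≤
      ε * (G₀ + G₁ * ‖gradient F x‖) := by
  obtain ⟨hi, hmean, hsq, hvar⟩ := hv x
  have hm0 : (0 : ℝ) < m := lt_of_lt_of_le (by positivity) hm
  set Y : Ξ → Vec n := fun ξ => gradient (fun y => f y ξ) x - gradient F x
  have hYint : Integrable Y D := hi.sub (integrable_const _)
  have hY : MemLp Y 2 D := (memLp_two_iff_integrable_sq_norm hYint.aestronglyMeasurable).2 hsq
  have hY0 : ∫ ξ, Y ξ ∂D = 0 := by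
    rw [integral_sub hi (integrable_const _), hmean]
    simp
  have e : ∀ s : Fin m → Ξ,
      gradient (batch f s) x - gradient F x = (1 / (m : ℝ)) • ∑ i, Y (s i) := by
    intro s
    rw [gradient_batch fun ξ => (hf.2 ξ).1, Finset.sum_sub_distrib, smul_sub]
    congr 1
    rw [Finset.sum_const, Finset.card_univ, Fintype.card_fin, ← Nat.cast_smul_eq_nsmul ℝ, smul_smul,
      one_div_mul_cancel hm0.ne', one_smul]
  have hmem : MemLp (fun s : Fin m → Ξ => gradient (batch f s) x - gradient F x) 2
      (Measure.pi fun _ => D) := by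
    simp only [e]
    exact hY.sum_eval.const_smul (1 / (m : ℝ))
  refine ⟨(hmem.integrable (by norm_num)).norm, integral_norm_le_of_sq hmem (by positivity) ?_⟩
  simp only [e, norm_smul, mul_pow]
  rw [integral_const_mul, integral_norm_sq_sum_eval hY hY0, Fintype.card_fin,
    Real.norm_of_nonneg (by positivity)]
  have h0 : 0 ≤ ∫ ξ, ‖Y ξ‖ ^ 2 ∂D := integral_nonneg fun _ => by positivity
  have hinv : 1 / (m : ℝ) ≤ ε ^ 2 := by
    rw [div_le_iff₀ (by positivity)] at hm
    rw [div_le_iff₀ hm0]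
    linarith
  calc (1 / (m : ℝ)) ^ 2 * (m * ∫ ξ, ‖Y ξ‖ ^ 2 ∂D) = 1 / (m : ℝ) * ∫ ξ, ‖Y ξ‖ ^ 2 ∂D := by
        field_simp
    _ ≤ ε ^ 2 * (G₀ ^ 2 + G₁ ^ 2 * ‖gradient F x‖ ^ 2) := by gcongr
    _ ≤ ε ^ 2 * (G₀ + G₁ * ‖gradient F x‖) ^ 2 := by
        gcongr
        have : 0 ≤ G₀ * (G₁ * ‖gradient F x‖) := by positivity
        nlinarith

theorem integral_norm_hessian_batch_sub_le (hn : 2 ≤ n) (hf : StochasticComponent f)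
    (hF : TwiceDifferentiable F) {K₀ K₁ : ℝ} (hK₀ : 0 ≤ K₀) (hK₁ : 0 ≤ K₁)
    (hv : HessianVarianceBounded D f F K₀ K₁) {r : ℝ} (hr : 0 < r) {m : ℕ}
    (hm : 22 * Real.log n / r ^ 2 ≤ m) (x : Vec n) :
    Integrable (fun s : Fin m → Ξ => ‖hessian (batch f s) x - hessian F x‖)
      (Measure.pi fun _ => D) ∧
    ∫ s : Fin m → Ξ, ‖hessian (batch f s) x - hessian F x‖ ∂(Measure.pi fun _ => D) ≤
      r * (K₀ + K₁ * ‖gradient F x‖) := by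
  obtain ⟨hi, hmean, hsq, hvar⟩ := hv x
  have hlog : 0 < Real.log n := Real.log_pos (by exact_mod_cast hn)
  have hm0 : (0 : ℝ) < m := lt_of_lt_of_le (by positivity) hm
  set Y : Ξ → Vec n →L[ℝ] Vec n := fun ξ => hessian (fun y => f y ξ) x - hessian F x with hYdef
  have hYint : Integrable Y D := hi.sub (integrable_const _)
  have hY : MemLp Y 2 D := (memLp_two_iff_integrable_sq_norm hYint.aestronglyMeasurable).2 hsq
  have hY0 : ∫ ξ, Y ξ ∂D = 0 := by
    rw [integral_sub hi (integrable_const _), hmean]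
    simp
  have hYs : ∀ ξ, (Y ξ : Vec n →ₗ[ℝ] Vec n).IsSymmetric := by
    intro ξ u v
    have h1 := (hf.2 ξ).hessian_isSymmetric x u v
    have h2 := hF.hessian_isSymmetric x u v
    simp only [ContinuousLinearMap.coe_coe] at h1 h2 ⊢
    simp only [hYdef, _root_.sub_apply, inner_sub_left, inner_sub_right, h1, h2]
  have e : ∀ s : Fin m → Ξ,
      hessian (batch f s) x - hessian F x = (1 / (m : ℝ)) • ∑ i, Y (s i) := by
    intro s
    rw [hessian_batch hf.2, Finset.sum_sub_distrib, smul_sub]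
    congr 1
    rw [Finset.sum_const, Finset.card_univ, Fintype.card_fin, ← Nat.cast_smul_eq_nsmul ℝ, smul_smul,
      one_div_mul_cancel hm0.ne', one_smul]
  have hmem : MemLp (fun s : Fin m → Ξ => hessian (batch f s) x - hessian F x) 2
      (Measure.pi fun _ => D) := by
    simp only [e]
    exact hY.sum_eval.const_smul (1 / (m : ℝ))
  refine ⟨(hmem.integrable (by norm_num)).norm, integral_norm_le_of_sq hmem (by positivity) ?_⟩
  simp only [e, norm_smul, mul_pow]
  rw [integral_const_mul, Real.norm_of_nonneg (by positivity)]
  have hbound := integral_opNorm_sq_sum_eval_le (ι := Fin m) hn finrank_euclideanSpace_fin hY hY0 hYs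
  rw [Fintype.card_fin] at hbound
  have h0 : 0 ≤ ∫ ξ, ‖Y ξ‖ ^ 2 ∂D := integral_nonneg fun _ => by positivity
  have hinv : 22 * Real.log n / m ≤ r ^ 2 := by
    rw [div_le_iff₀ (by positivity)] at hm
    rw [div_le_iff₀ hm0]
    linarith
  calc (1 / (m : ℝ)) ^ 2 * ∫ s : Fin m → Ξ, ‖∑ i, Y (s i)‖ ^ 2 ∂(Measure.pi fun _ => D)
      ≤ (1 / (m : ℝ)) ^ 2 * (22 * Real.log n * (m * ∫ ξ, ‖Y ξ‖ ^ 2 ∂D)) := by gcongr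
    _ = 22 * Real.log n / m * ∫ ξ, ‖Y ξ‖ ^ 2 ∂D := by field_simp
    _ ≤ r ^ 2 * (K₀ ^ 2 + K₁ ^ 2 * ‖gradient F x‖ ^ 2) := by gcongr
    _ ≤ r ^ 2 * (K₀ + K₁ * ‖gradient F x‖) ^ 2 := by
        gcongr
        have : 0 ≤ K₀ * (K₁ * ‖gradient F x‖) := by positivity
        nlinarith

end BatchError

/-! ### Fresh samples -/

/-- Integrating out an independent sample. -/
theorem ProbabilityTheory.IndepFun.integral_le_of_forall_integral_le {Ω α β : Type*}
    [MeasurableSpace Ω] [MeasurableSpace α] [MeasurableSpace β] {P : Measure Ω}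
    [IsProbabilityMeasure P] {X : Ω → α} {Z : Ω → β} (hX : Measurable X) (hZ : Measurable Z)
    (hind : IndepFun X Z P) {Φ : α → β → ℝ} (hΦ : Measurable (Function.uncurry Φ))
    (hΦ0 : ∀ x z, 0 ≤ Φ x z) {b : α → ℝ} (hb : Measurable b)
    (hint : ∀ x, Integrable (Φ x) (P.map Z)) (hle : ∀ x, ∫ z, Φ x z ∂(P.map Z) ≤ b x)
    (hbX : Integrable (fun ω => b (X ω)) P) :
    Integrable (fun ω => Φ (X ω) (Z ω)) P ∧ ∫ ω, Φ (X ω) (Z ω) ∂P ≤ ∫ ω, b (X ω) ∂P := by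
  have : IsProbabilityMeasure (P.map Z) := Measure.isProbabilityMeasure_map hZ.aemeasurable
  have : IsProbabilityMeasure (P.map X) := Measure.isProbabilityMeasure_map hX.aemeasurable
  have hmap := hind.map_prod_eq_prod_map_map hX.aemeasurable hZ.aemeasurable
  have hbmap : Integrable b (P.map X) :=
    (integrable_map_measure hb.aestronglyMeasurable hX.aemeasurable).2 hbX
  have hprod : Integrable (Function.uncurry Φ) ((P.map X).prod (P.map Z)) := by
    rw [integrable_prod_iff hΦ.aestronglyMeasurable]
    refine ⟨Filter.Eventually.of_forall fun x => hint x, ?_⟩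
    refine hbmap.mono' hΦ.aestronglyMeasurable.norm.integral_prod_right'
      (Filter.Eventually.of_forall fun x => ?_)
    have e : ∀ z, ‖Function.uncurry Φ (x, z)‖ = Φ x z := fun z => Real.norm_of_nonneg (hΦ0 x z)
    simp only [e]
    rw [Real.norm_of_nonneg (integral_nonneg (hΦ0 x))]
    exact hle x
  have hXZ : Measurable fun ω => (X ω, Z ω) := hX.prodMk hZ
  rw [← hmap] at hprod
  refine ⟨(integrable_map_measure hΦ.aestronglyMeasurable hXZ.aemeasurable).1 hprod, ?_⟩
  calc ∫ ω, Φ (X ω) (Z ω) ∂P = ∫ p, Function.uncurry Φ p ∂(P.map fun ω => (X ω, Z ω)) :=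
        (integral_map hXZ.aemeasurable hΦ.aestronglyMeasurable).symm
    _ = ∫ x, ∫ z, Φ x z ∂(P.map Z) ∂(P.map X) := by
        rw [hmap] at hprod ⊢
        exact integral_prod _ hprod
    _ ≤ ∫ x, b x ∂(P.map X) := by
        refine integral_mono ?_ hbmap hle
        rw [hmap] at hprod
        exact hprod.integral_prod_left
    _ = ∫ ω, b (X ω) ∂P := integral_map hX.aemeasurable hb.aestronglyMeasurable

/-! ### Runs of the method -/

namespace IsSOTRGSRun

variable {n : ℕ} {Ξ Ω : Type*} [MeasurableSpace Ξ] [mΩ : MeasurableSpace Ω] {P : Measure Ω}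
  {D : Measure Ξ} {f : Vec n → Ξ → ℝ}
  {F : Vec n → ℝ} {x₀ : Vec n} {Δ : ℝ} {T m₁ m₂ : ℕ} {ℱ : Filtration (Fin (T + 1)) mΩ}
  {S : Fin T → IterSample m₁ m₂ → Ω → Ξ} {X : Fin (T + 1) → Ω → Vec n}

theorem measurable_iterate (h : IsSOTRGSRun P D f F x₀ Δ T m₁ m₂ ℱ S X) (t : Fin (T + 1)) :
    Measurable (X t) :=
  (h.iterate_known t).mono (ℱ.le t) le_rfl

theorem measurable_sample (h : IsSOTRGSRun P D f F x₀ Δ T m₁ m₂ ℱ S X) (t : Fin T)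
    (i : IterSample m₁ m₂) : Measurable (S t i) :=
  (h.sample_known t i).mono (ℱ.le t.succ) le_rfl

theorem norm_iterate_sub_le (h : IsSOTRGSRun P D f F x₀ Δ T m₁ m₂ ℱ S X) (t : Fin (T + 1))
    (ω : Ω) : ‖X t ω - x₀‖ ≤ t.val * Δ := by
  induction t using Fin.induction with
  | zero => simp [h.init ω]
  | succ t ih =>
    obtain ⟨d, hd, hX⟩ := h.step t ω
    have e : X t.succ ω - x₀ = (X t.castSucc ω - x₀) + d := by rw [hX]; abel
    rw [e]
    refine (norm_add_le _ _).trans ?_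
    have := hd.1
    simp only [Fin.val_castSucc, Fin.val_succ, Nat.cast_add, Nat.cast_one] at ih ⊢
    linarith

/-- `j` selects the gradient half or the Hessian half of the samples. -/
theorem indepFun_iterate_sample (h : IsSOTRGSRun P D f F x₀ Δ T m₁ m₂ ℱ S X) (t : Fin T)
    {κ : Type*} (j : κ → IterSample m₁ m₂) :
    IndepFun (X t.castSucc) (fun ω i => S t (j i) ω) P := by
  have h1 : IndepFun (X t.castSucc) (fun ω i => S t i ω) P := by
    rw [IndepFun_iff_Indep]
    exact indep_of_indep_of_le_left (h.sample_fresh t) (h.iterate_known t.castSucc).comap_le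
  have hj : Measurable fun (s : IterSample m₁ m₂ → Ξ) (i : κ) => s (j i) :=
    measurable_pi_lambda _ fun i => measurable_pi_apply (j i)
  exact h1.comp measurable_id hj

theorem map_sample (h : IsSOTRGSRun P D f F x₀ Δ T m₁ m₂ ℱ S X) (t : Fin T) {κ : Type*}
    [Fintype κ] {j : κ → IterSample m₁ m₂} (hj : Function.Injective j) :
    P.map (fun ω i => S t (j i) ω) = Measure.pi fun _ => D := by
  have h1 : iIndepFun (fun i => S t (j i)) P := (h.sample_iIndep t).precomp hj
  rw [h1.map_fun_eq_pi_map fun i => (h.measurable_sample t (j i)).aemeasurable]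
  simp only [h.sample_law t]

variable [IsProbabilityMeasure P]

/-- Steps have length at most `Δ`, so each iterate stays in a deterministic compact ball, where a
continuous function is bounded. -/
theorem integrable_comp_iterate (h : IsSOTRGSRun P D f F x₀ Δ T m₁ m₂ ℱ S X) (t : Fin (T + 1))
    {φ : Vec n → ℝ} (hφ : Continuous φ) : Integrable (fun ω => φ (X t ω)) P := by
  obtain ⟨C, hC⟩ := (isCompact_closedBall x₀ (t.val * Δ)).exists_bound_of_continuousOn
    hφ.continuousOn
  refine Integrable.of_bound (hφ.measurable.comp (h.measurable_iterate t)).aestronglyMeasurable C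
    (Filter.Eventually.of_forall fun ω => hC _ ?_)
  rw [Metric.mem_closedBall, dist_eq_norm]
  exact h.norm_iterate_sub_le t ω

variable [IsProbabilityMeasure D]

theorem integral_gradient_error_le (h : IsSOTRGSRun P D f F x₀ Δ T m₁ m₂ ℱ S X)
    (hf : StochasticComponent f) (hF : TwiceDifferentiable F) {G₀ G₁ : ℝ} (hG₀ : 0 ≤ G₀)
    (hG₁ : 0 ≤ G₁) (hv : GradientVarianceBounded D f F G₀ G₁) {ε : ℝ} (hε : 0 < ε)
    (hm : 1 / ε ^ 2 ≤ m₁) (t : Fin T) :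
    Integrable (fun ω => ‖gradient (batch f fun i => S t (Sum.inl i) ω) (X t.castSucc ω)
      - gradient F (X t.castSucc ω)‖) P ∧
    ∫ ω, ‖gradient (batch f fun i => S t (Sum.inl i) ω) (X t.castSucc ω)
      - gradient F (X t.castSucc ω)‖ ∂P ≤
      ε * (G₀ + G₁ * ∫ ω, ‖gradient F (X t.castSucc ω)‖ ∂P) := by
  have hgc : Continuous (gradient F) := hF.2.continuous
  have hgi : Integrable (fun ω => ‖gradient F (X t.castSucc ω)‖) P :=
    h.integrable_comp_iterate t.castSucc hgc.norm
  have hmap := h.map_sample t (j := Sum.inl) Sum.inl_injective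
  have hkey := (h.indepFun_iterate_sample t Sum.inl).integral_le_of_forall_integral_le
    (h.measurable_iterate t.castSucc)
    (measurable_pi_lambda _ fun i => h.measurable_sample t (Sum.inl i))
    (Φ := fun x s => ‖gradient (batch f s) x - gradient F x‖)
    (b := fun x => ε * (G₀ + G₁ * ‖gradient F x‖))
    ((measurable_gradient_batch hf m₁).sub (hgc.measurable.comp measurable_fst)).norm
    (fun _ _ => norm_nonneg _) (by have := hgc.measurable; fun_prop)
    (fun x => by
      rw [hmap]
      exact (integral_norm_gradient_batch_sub_le hf hG₀ hG₁ hv hε hm x).1)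
    (fun x => by
      rw [hmap]
      exact (integral_norm_gradient_batch_sub_le hf hG₀ hG₁ hv hε hm x).2)
    (((integrable_const G₀).add (hgi.const_mul G₁)).const_mul ε)
  refine ⟨hkey.1, hkey.2.trans (le_of_eq ?_)⟩
  rw [integral_const_mul, integral_add (integrable_const _) (hgi.const_mul _), integral_const_mul]
  simp

theorem integral_hessian_error_le (h : IsSOTRGSRun P D f F x₀ Δ T m₁ m₂ ℱ S X) (hn : 2 ≤ n)
    (hf : StochasticComponent f) (hF : TwiceDifferentiable F) (hc : Continuous (hessian F))
    {K₀ K₁ : ℝ} (hK₀ : 0 ≤ K₀) (hK₁ : 0 ≤ K₁) (hv : HessianVarianceBounded D f F K₀ K₁) {r : ℝ}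
    (hr : 0 < r) (hm : 22 * Real.log n / r ^ 2 ≤ m₂) (t : Fin T) :
    Integrable (fun ω => ‖hessian (batch f fun i => S t (Sum.inr i) ω) (X t.castSucc ω)
      - hessian F (X t.castSucc ω)‖) P ∧
    ∫ ω, ‖hessian (batch f fun i => S t (Sum.inr i) ω) (X t.castSucc ω)
      - hessian F (X t.castSucc ω)‖ ∂P ≤
      r * (K₀ + K₁ * ∫ ω, ‖gradient F (X t.castSucc ω)‖ ∂P) := by
  have hgc : Continuous (gradient F) := hF.2.continuous
  have hgi : Integrable (fun ω => ‖gradient F (X t.castSucc ω)‖) P :=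
    h.integrable_comp_iterate t.castSucc hgc.norm
  have hmap := h.map_sample t (j := Sum.inr) Sum.inr_injective
  have hkey := (h.indepFun_iterate_sample t Sum.inr).integral_le_of_forall_integral_le
    (h.measurable_iterate t.castSucc)
    (measurable_pi_lambda _ fun i => h.measurable_sample t (Sum.inr i))
    (Φ := fun x s => ‖hessian (batch f s) x - hessian F x‖)
    (b := fun x => r * (K₀ + K₁ * ‖gradient F x‖))
    ((measurable_hessian_batch hf m₂).sub (hc.measurable.comp measurable_fst)).norm
    (fun _ _ => norm_nonneg _) (by have := hgc.measurable; fun_prop)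
    (fun x => by
      rw [hmap]
      exact (integral_norm_hessian_batch_sub_le hn hf hF hK₀ hK₁ hv hr hm x).1)
    (fun x => by
      rw [hmap]
      exact (integral_norm_hessian_batch_sub_le hn hf hF hK₀ hK₁ hv hr hm x).2)
    (((integrable_const K₀).add (hgi.const_mul K₁)).const_mul r)
  refine ⟨hkey.1, hkey.2.trans (le_of_eq ?_)⟩
  rw [integral_const_mul, integral_add (integrable_const _) (hgi.const_mul _), integral_const_mul]
  simp

/-- A pathwise descent inequality, summed in expectation over a run. -/
theorem sum_integral_le_of_descent {r : ℝ} (h : IsSOTRGSRun P D f F x₀ r T m₁ m₂ ℱ S X)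
    (hn : 2 ≤ n) (hf : StochasticComponent f) (hb : BddBelow (Set.range F))
    (hF : TwiceDifferentiable F) (hc : Continuous (hessian F))
    {G₀ G₁ K₀ K₁ : ℝ} (hG₀ : 0 ≤ G₀) (hG₁ : 0 ≤ G₁) (hvG : GradientVarianceBounded D f F G₀ G₁)
    (hK₀ : 0 ≤ K₀) (hK₁ : 0 ≤ K₁) (hvK : HessianVarianceBounded D f F K₀ K₁)
    (hr : 0 < r) (hm₁ : 1 / (r ^ 2) ^ 2 ≤ m₁) (hm₂ : 22 * Real.log n / r ^ 2 ≤ m₂)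
    {φ : Vec n → ℝ} (hφ : Continuous φ) {Q κ : ℝ} (hκ : 0 ≤ κ)
    (hdesc : ∀ (x g d : Vec n) (B : Vec n →L[ℝ] Vec n), (B : Vec n →ₗ[ℝ] Vec n).IsSymmetric →
      IsTRSolution (F x) g B r d →
      F (x + d) - F x + φ (x + d) ≤ 3 / 2 * r * ‖g - gradient F x‖ + r ^ 2 * ‖B - hessian F x‖
        + r ^ 3 * (Q + κ * ‖gradient F x‖)) :
    ∑ t : Fin T, ∫ ω, φ (X t.succ ω) ∂P ≤ initialGap F x₀ + T * r ^ 3 * (3 / 2 * G₀ + K₀ + Q)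
      + r ^ 3 * (3 / 2 * G₁ + K₁ + κ) *
        (‖gradient F x₀‖ + ∑ t : Fin T, ∫ ω, ‖gradient F (X t.succ ω)‖ ∂P) := by
  have hgc : Continuous (gradient F) := hF.2.continuous
  set v : Fin (T + 1) → ℝ := fun t => ∫ ω, F (X t ω) ∂P with hvdef
  set u : Fin (T + 1) → ℝ := fun t => ∫ ω, ‖gradient F (X t ω)‖ ∂P with hudef
  have hvi : ∀ t, Integrable (fun ω => F (X t ω)) P := fun t =>
    h.integrable_comp_iterate t hF.1.continuous
  have hui : ∀ t, Integrable (fun ω => ‖gradient F (X t ω)‖) P := fun t =>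
    h.integrable_comp_iterate t hgc.norm
  have hφi : ∀ t, Integrable (fun ω => φ (X t ω)) P := fun t => h.integrable_comp_iterate t hφ
  -- The expected gradient error has order `r²` and is weighted by `r`; the Hessian error has order
  -- `r` and is weighted by `r²`. All errors thus have order `r³`.
  have hstep : ∀ t : Fin T, v t.succ - v t.castSucc + ∫ ω, φ (X t.succ ω) ∂P ≤
      r ^ 3 * (3 / 2 * G₀ + K₀ + Q) + r ^ 3 * (3 / 2 * G₁ + K₁ + κ) * u t.castSucc := by
    intro t
    obtain ⟨hgi, hge⟩ := h.integral_gradient_error_le hf hF hG₀ hG₁ hvG (pow_pos hr 2) hm₁ t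
    obtain ⟨hhi, hhe⟩ := h.integral_hessian_error_le hn hf hF hc hK₀ hK₁ hvK hr hm₂ t
    set eg : Ω → ℝ := fun ω => ‖gradient (batch f fun i => S t (Sum.inl i) ω) (X t.castSucc ω)
      - gradient F (X t.castSucc ω)‖
    set eh : Ω → ℝ := fun ω => ‖hessian (batch f fun i => S t (Sum.inr i) ω) (X t.castSucc ω)
      - hessian F (X t.castSucc ω)‖
    have hq : Integrable (fun ω => Q + κ * ‖gradient F (X t.castSucc ω)‖) P :=
      (integrable_const Q).add ((hui t.castSucc).const_mul κ)
    have hd : Integrable (fun ω => F (X t.succ ω) - F (X t.castSucc ω)) P :=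
      (hvi t.succ).sub (hvi t.castSucc)
    have he : Integrable (fun ω => 3 / 2 * r * eg ω + r ^ 2 * eh ω) P :=
      (hgi.const_mul _).add (hhi.const_mul _)
    have hpath := integral_mono
      (f := fun ω => F (X t.succ ω) - F (X t.castSucc ω) + φ (X t.succ ω))
      (g := fun ω => 3 / 2 * r * eg ω + r ^ 2 * eh ω
        + r ^ 3 * (Q + κ * ‖gradient F (X t.castSucc ω)‖))
      (hd.add (hφi t.succ)) (he.add (hq.const_mul _))
      (fun ω => by
        obtain ⟨d, hd, hX⟩ := h.step t ω
        simp only [hX, eg, eh]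
        exact hdesc _ _ _ _ ((twiceDifferentiable_batch hf.2 _).hessian_isSymmetric _) hd)
    rw [integral_add hd (hφi t.succ), integral_sub (hvi t.succ) (hvi t.castSucc),
      integral_add he (hq.const_mul _), integral_add (hgi.const_mul _) (hhi.const_mul _),
      integral_const_mul, integral_const_mul, integral_const_mul,
      integral_add (integrable_const Q) ((hui t.castSucc).const_mul κ),
      integral_const_mul] at hpath
    simp only [integral_const, probReal_univ, one_smul] at hpath
    have h1 := mul_le_mul_of_nonneg_left hge (show 0 ≤ 3 / 2 * r by positivity)
    have h2 := mul_le_mul_of_nonneg_left hhe (show 0 ≤ r ^ 2 by positivity)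
    simp only [hvdef, hudef]
    linarith
  have hsum := Finset.sum_le_sum fun t (_ : t ∈ (Finset.univ : Finset (Fin T))) => hstep t
  rw [Finset.sum_add_distrib, Finset.sum_add_distrib, Finset.sum_sub_distrib,
    Finset.sum_const, Finset.card_univ, Fintype.card_fin, nsmul_eq_mul, ← Finset.mul_sum] at hsum
  have hv0 : v 0 = F x₀ := by simp [hvdef, h.init]
  have hu0 : u 0 = ‖gradient F x₀‖ := by simp [hudef, h.init]
  have htel : ∑ t : Fin T, v t.succ - ∑ t : Fin T, v t.castSucc = v (Fin.last T) - v 0 := by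
    have := (Fin.sum_univ_succ v).symm.trans (Fin.sum_univ_castSucc v)
    linarith
  -- The errors involve the gradient before each step and the conclusion the gradient after it. The
  -- shift adds the term at `x₀` and drops a nonnegative last term.
  have hutel : ∑ t : Fin T, u t.castSucc ≤ u 0 + ∑ t : Fin T, u t.succ := by
    have := (Fin.sum_univ_succ u).symm.trans (Fin.sum_univ_castSucc u)
    have hl : 0 ≤ u (Fin.last T) := integral_nonneg fun _ => norm_nonneg _
    linarith
  have hlast : ⨅ x, F x ≤ v (Fin.last T) := by
    have := integral_mono (integrable_const (⨅ x, F x)) (hvi (Fin.last T))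
      fun ω => ciInf_le hb (X (Fin.last T) ω)
    simpa using this
  have hmul := mul_le_mul_of_nonneg_left hutel
    (show 0 ≤ r ^ 3 * (3 / 2 * G₁ + K₁ + κ) by positivity)
  rw [hu0] at hmul
  rw [htel, hv0] at hsum
  rw [initialGap]
  linarith

end IsSOTRGSRun

/-- Expectations at a uniformly distributed independent index are averages. -/
theorem IsUniformIndex.integral_comp {n T : ℕ} {Ω : Type*} [MeasurableSpace Ω] {P : Measure Ω}
    [IsProbabilityMeasure P] {X : Fin (T + 1) → Ω → Vec n} {τ : Ω → Fin T}
    (hτ : IsUniformIndex P X τ) {φ : Vec n → ℝ} (hφ : Measurable φ)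
    (hint : ∀ t, Integrable (fun ω => φ (X t ω)) P) :
    Integrable (fun ω => φ (X (τ ω).succ ω)) P ∧
      ∫ ω, φ (X (τ ω).succ ω) ∂P = (T : ℝ)⁻¹ * ∑ t : Fin T, ∫ ω, φ (X t.succ ω) ∂P := by
  -- The value at the random index is split over the events `τ = k`, and independence factors each
  -- expectation.
  set χ : Fin T → Fin T → ℝ := fun k j => if j = k then 1 else 0
  have hχ : ∀ k, Measurable (χ k) := fun k => measurable_of_finite _
  have e : (fun ω => φ (X (τ ω).succ ω)) =
      fun ω => ∑ k : Fin T, χ k (τ ω) * φ (X k.succ ω) := by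
    funext ω
    simp [χ]
  have hχint : ∀ k, ∫ ω, χ k (τ ω) ∂P = (T : ℝ)⁻¹ := by
    intro k
    have hset : MeasurableSet {ω | τ ω = k} := hτ.1 (measurableSet_singleton k)
    have : (fun ω => χ k (τ ω)) = Set.indicator {ω | τ ω = k} 1 := by
      funext ω
      simp [χ, Set.indicator_apply]
    rw [this, integral_indicator_one hset, measureReal_def, hτ.2.1 k]
    simp
  have hind : ∀ k : Fin T, IndepFun (fun ω => χ k (τ ω)) (fun ω => φ (X k.succ ω)) P := fun k =>
    hτ.2.2.comp (hχ k) (hφ.comp (measurable_pi_apply k.succ))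
  have hχi : ∀ k, Integrable (fun ω => χ k (τ ω)) P := by
    intro k
    refine Integrable.of_bound ((hχ k).comp hτ.1).aestronglyMeasurable 1
      (Filter.Eventually.of_forall fun ω => ?_)
    simp only [χ]
    split <;> simp
  have hterm : ∀ k : Fin T, Integrable (fun ω => χ k (τ ω) * φ (X k.succ ω)) P := fun k =>
    (hind k).integrable_mul (hχi k) (hint k.succ)
  rw [e]
  refine ⟨integrable_finsetSum _ fun k _ => hterm k, ?_⟩
  rw [integral_finsetSum _ fun k _ => hterm k, Finset.mul_sum]
  refine Finset.sum_congr rfl fun k _ => ?_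
  rw [(hind k).integral_fun_mul_eq_mul_integral (hχi k).aestronglyMeasurable
    (hint k.succ).aestronglyMeasurable, hχint]

/-! ### The complexity bound -/

/-- By `2r ≤ 1 + r²`. This controls first powers of `r` in terms of `a`, as `r ≤ 1` is not
available. -/
theorem mul_le_add_one_of_mul_sq_le {a r : ℝ} (ha : 0 ≤ a) (h : a * r ^ 2 ≤ 2) : a * r ≤ a + 1 := by
  nlinarith [mul_nonneg ha (sq_nonneg (r - 1))]

theorem rpow_three_halves_eq_sqrt_pow {ε : ℝ} (hε : 0 < ε) : ε ^ (3 / 2 : ℝ) = √ε ^ 3 := by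
  rw [Real.sqrt_eq_rpow, ← Real.rpow_natCast, ← Real.rpow_mul hε.le]
  norm_num

/-- Solving the summed gradient inequality. -/
theorem average_gradient_le {r c A a L₀ gap g₀ G T : ℝ} (hr : 0 < r) (hc : 0 < c) (hT : 1 ≤ T)
    (ha : 0 ≤ a) (har : a * r ^ 2 ≤ 2 / 5) (hL₀ : 0 ≤ L₀) (hG : 0 ≤ G)
    (hgap : gap ≤ T * r ^ 3 / c) (hg₀ : g₀ ≤ 4 * gap / r + L₀ * r)
    (h : 1 / 2 * r * G ≤ gap + T * r ^ 3 * A + r ^ 3 * a * (g₀ + G)) :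
    T⁻¹ * G ≤ 10 * (3 / c + A + L₀ * (a + 1)) * r ^ 2 ∧
      g₀ ≤ T * (4 / c * r ^ 2 + L₀ * r) := by
  have hg : g₀ ≤ T * (4 / c * r ^ 2 + L₀ * r) := by
    refine hg₀.trans ?_
    have h1 : 4 * gap / r ≤ 4 * (T * r ^ 3 / c) / r := by gcongr
    have h2 : 4 * (T * r ^ 3 / c) / r = T * (4 / c * r ^ 2) := by field_simp
    have h3 : L₀ * r ≤ T * (L₀ * r) := le_mul_of_one_le_left (by positivity) hT
    linarith
  refine ⟨?_, hg⟩
  have hT0 : 0 < T := by linarith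
  have har' := mul_le_add_one_of_mul_sq_le ha (by linarith : a * r ^ 2 ≤ 2)
  have h1 : r ^ 3 * a * g₀ ≤ T * r ^ 3 * (2 / c + L₀ * (a + 1)) := by
    calc r ^ 3 * a * g₀ ≤ r ^ 3 * a * (T * (4 / c * r ^ 2 + L₀ * r)) := by gcongr
      _ = T * r ^ 3 * (4 / c * (a * r ^ 2) + L₀ * (a * r)) := by ring
      _ ≤ T * r ^ 3 * (4 / c * (2 / 5) + L₀ * (a + 1)) := by gcongr
      _ ≤ T * r ^ 3 * (2 / c + L₀ * (a + 1)) := by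
          gcongr
          rw [div_mul_eq_mul_div]
          gcongr
          norm_num
  -- The absorption: `1/2 - 2/5 = 1/10` of the left side remains, hence the factor `10` in the
  -- conclusion.
  have h2 : r ^ 3 * a * G ≤ 2 / 5 * r * G := by
    calc r ^ 3 * a * G = a * r ^ 2 * (r * G) := by ring
      _ ≤ 2 / 5 * (r * G) := by gcongr
      _ = _ := by ring
  have h3 : r * G ≤ r * (T * (10 * (3 / c + A + L₀ * (a + 1)) * r ^ 2)) := by
    have e : T * r ^ 3 / c = T * r ^ 3 * (1 / c) := by ring
    have e2 : 3 / c = 1 / c + 2 / c := by ring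
    rw [e] at hgap
    rw [e2]
    linarith
  rw [inv_mul_le_iff₀ hT0]
  exact le_of_mul_le_mul_left h3 hr

/-- Solving the summed curvature inequality. -/
theorem average_curvature_le {r c A b L₀ gap g₀ G Λ C₁ T : ℝ} (hr : 0 < r) (hc : 0 < c)
    (hT : 0 < T) (hb : 0 ≤ b) (hbr : b * r ^ 2 ≤ 2) (hL₀ : 0 ≤ L₀) (hC₁ : 0 ≤ C₁)
    (hgap : gap ≤ T * r ^ 3 / c) (hG : T⁻¹ * G ≤ C₁ * r ^ 2)
    (hg₀ : g₀ ≤ T * (4 / c * r ^ 2 + L₀ * r))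
    (h : -(1 / 2 * r ^ 2 * Λ) ≤ gap + T * r ^ 3 * A + r ^ 3 * b * (g₀ + G)) :
    -(2 * (9 / c + A + L₀ * (b + 1) + 2 * C₁) * r) ≤ T⁻¹ * Λ := by
  have hbr' := mul_le_add_one_of_mul_sq_le hb hbr
  rw [inv_mul_le_iff₀ hT] at hG
  -- Nothing has to be absorbed here, since `G` is already bounded by `T C₁ r²`; it is enough that
  -- `b r²` is bounded.
  have h1 : r ^ 3 * b * (g₀ + G) ≤ T * r ^ 3 * (8 / c + L₀ * (b + 1) + 2 * C₁) := by
    calc r ^ 3 * b * (g₀ + G)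
        ≤ r ^ 3 * b * (T * (4 / c * r ^ 2 + L₀ * r) + T * (C₁ * r ^ 2)) := by gcongr
      _ = T * r ^ 3 * (4 / c * (b * r ^ 2) + L₀ * (b * r) + (b * r ^ 2) * C₁) := by ring
      _ ≤ T * r ^ 3 * (4 / c * 2 + L₀ * (b + 1) + 2 * C₁) := by gcongr
      _ = _ := by ring
  have h2 : r ^ 2 * (T * -(2 * (9 / c + A + L₀ * (b + 1) + 2 * C₁) * r)) ≤ r ^ 2 * Λ := by
    have e : T * r ^ 3 / c = T * r ^ 3 * (1 / c) := by ring
    have e2 : 9 / c = 1 / c + 8 / c := by ring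
    rw [e] at hgap
    rw [e2]
    linarith
  rw [le_inv_mul_iff₀ hT]
  exact le_of_mul_le_mul_left h2 (by positivity)

theorem sampleCount_le {n T m₁ m₂ : ℕ} {c ε gap : ℝ} (hc : 0 < c) (hε : 0 < ε) (hε1 : ε ≤ 1)
    (hgap : ε ^ (3 / 2 : ℝ) ≤ c * gap) (hm₁ : m₁ = ⌈1 / ε ^ 2⌉₊)
    (hm₂ : m₂ = ⌈22 * Real.log n / ε⌉₊) (hT : T = ⌈c * gap * ε ^ (-(3 / 2) : ℝ)⌉₊) :
    (sampleCount T m₁ m₂ : ℝ) ≤ 44 * c *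
      (gap * ε ^ (-(7 / 2) : ℝ) + Real.log n * gap * ε ^ (-(5 / 2) : ℝ)) := by
  have hlog : 0 ≤ Real.log n := Real.log_natCast_nonneg n
  set w := ε ^ (-(3 / 2) : ℝ) with hw
  set p := 1 / ε with hp
  have hw0 : 0 < w := Real.rpow_pos_of_pos hε _
  have hp1 : 1 ≤ p := by rw [hp, le_div_iff₀ hε]; linarith
  have hgap0 : 0 < gap := by
    have : 0 < c * gap := lt_of_lt_of_le (Real.rpow_pos_of_pos hε _) hgap
    exact pos_of_mul_pos_right this hc.le
  have e7 : ε ^ (-(7 / 2) : ℝ) = w * p ^ 2 := by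
    rw [hw, hp, one_div, ← Real.rpow_neg_one, ← Real.rpow_natCast, ← Real.rpow_mul hε.le,
      ← Real.rpow_add hε]
    norm_num
  have e5 : ε ^ (-(5 / 2) : ℝ) = w * p := by
    rw [hw, hp, one_div, ← Real.rpow_neg_one, ← Real.rpow_add hε]
    norm_num
  have hcw : 1 ≤ c * gap * w := by
    have : ε ^ (3 / 2 : ℝ) * w = 1 := by
      rw [hw, ← Real.rpow_add hε]
      norm_num
    rw [← this]
    gcongr
  -- The assumption on the gap makes the number under the ceiling at least `1`, so rounding at most
  -- doubles it. In the batch sizes rounding is absorbed by `p² ≥ 1`.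
  have hTle : (T : ℝ) ≤ 2 * (c * gap * w) := by
    have := Nat.ceil_lt_add_one (show 0 ≤ c * gap * w by positivity)
    rw [← hT] at this
    linarith
  have hm₁le : (m₁ : ℝ) ≤ 2 * p ^ 2 := by
    have := Nat.ceil_lt_add_one (show 0 ≤ 1 / ε ^ 2 by positivity)
    rw [← hm₁] at this
    have e : 1 / ε ^ 2 = p ^ 2 := by rw [hp]; ring
    rw [e] at this
    nlinarith
  have hm₂le : (m₂ : ℝ) ≤ 22 * Real.log n * p + p ^ 2 := by
    have := Nat.ceil_lt_add_one (show 0 ≤ 22 * Real.log n / ε by positivity)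
    rw [← hm₂] at this
    have e : 22 * Real.log n / ε = 22 * Real.log n * p := by rw [hp]; ring
    rw [e] at this
    nlinarith
  have hcount : (sampleCount T m₁ m₂ : ℝ) = T * (m₁ + m₂) := by simp [sampleCount]
  rw [hcount, e7, e5]
  calc (T : ℝ) * (m₁ + m₂)
      ≤ 2 * (c * gap * w) * (2 * p ^ 2 + (22 * Real.log n * p + p ^ 2)) := by gcongr
    _ = c * (gap * (w * p ^ 2)) * 6 + 44 * c * (Real.log n * gap * (w * p)) := by ring
    _ ≤ c * (gap * (w * p ^ 2)) * 44 + 44 * c * (Real.log n * gap * (w * p)) := by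
        gcongr
        norm_num
    _ = _ := by ring

theorem mainTheorem2 (L₀ L₁ M₀ M₁ G₀ G₁ K₀ K₁ c : ℝ)
    (hL₀ : 0 < L₀) (hL₁ : 0 ≤ L₁) (hM₀ : 0 < M₀) (hM₁ : 0 ≤ M₁)
    (hG₀ : 0 ≤ G₀) (hG₁ : 0 ≤ G₁) (hK₀ : 0 ≤ K₀) (hK₁ : 0 ≤ K₁) (hc : 0 < c) :
    ∃ C : ℝ, 0 < C ∧
      ∀ (n : ℕ) (_ : 2 ≤ n)
        (Ξ : Type*) [MeasurableSpace Ξ] (D : Measure Ξ) [IsProbabilityMeasure D]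
        (f : Vec n → Ξ → ℝ) (F : Vec n → ℝ) (δ : ℝ) (x₀ : Vec n)
        (_ : StochasticComponent f) (_ : BddBelow (Set.range F))
        (_ : GeneralizedSmooth F L₀ L₁) (_ : GradientVarianceBounded D f F G₀ G₁)
        (_ : 0 < δ) (_ : SecondOrderGeneralizedSmooth F δ M₀ M₁)
        (_ : HessianVarianceBounded D f F K₀ K₁)
        (ε : ℝ) (_ : 0 < ε) (_ : ε * (5 * M₁ + 18 * G₁ + 12 * K₁) < 3) (_ : ε * L₁ ^ 2 < 1)
        (m₁ m₂ T : ℕ) (_ : m₁ = ⌈1 / ε ^ 2⌉₊) (_ : m₂ = ⌈22 * Real.log n / ε⌉₊)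
        (_ : T = ⌈c * initialGap F x₀ * ε ^ (-(3 / 2) : ℝ)⌉₊),
        (∀ (Ω : Type*) [mΩ : MeasurableSpace Ω] (P : Measure Ω) [IsProbabilityMeasure P]
          (ℱ : Filtration (Fin (T + 1)) mΩ) (S : Fin T → IterSample m₁ m₂ → Ω → Ξ)
          (X : Fin (T + 1) → Ω → Vec n) (τ : Ω → Fin T)
          (_ : IsSOTRGSRun P D f F x₀ (Real.sqrt ε) T m₁ m₂ ℱ S X) (_ : IsUniformIndex P X τ),
          Integrable (fun ω => ‖gradient F (X (τ ω).succ ω)‖) P ∧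
          ∫ ω, ‖gradient F (X (τ ω).succ ω)‖ ∂P ≤ C * ε ∧
          Integrable (fun ω => lambdaMin (hessian F (X (τ ω).succ ω))) P ∧
          -(C * Real.sqrt ε) ≤ ∫ ω, lambdaMin (hessian F (X (τ ω).succ ω)) ∂P) ∧
        (ε ≤ 1 → ε ^ (3 / 2 : ℝ) ≤ c * initialGap F x₀ →
          (sampleCount T m₁ m₂ : ℝ) ≤
            C * (initialGap F x₀ * ε ^ (-(7 / 2) : ℝ)
              + Real.log n * initialGap F x₀ * ε ^ (-(5 / 2) : ℝ))) := by
  -- `Q` bounds `M₀ + M₁ L₀ r` independently of `ε`, through `M₁ r ≤ M₁ + 1`.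
  set Q := M₀ + (M₁ + 1) * L₀ with hQdef
  set A := 3 / 2 * G₀ + K₀ + Q with hA
  set a := 3 / 2 * G₁ + K₁ + 2 / 3 * M₁ with ha
  set b := 3 / 2 * G₁ + K₁ + 2 * M₁ with hb
  have hQ0 : 0 ≤ Q := by positivity
  have hA0 : 0 ≤ A := by positivity
  have ha0 : 0 ≤ a := by positivity
  have hb0 : 0 ≤ b := by positivity
  set C₁ := 10 * (3 / c + A + L₀ * (a + 1)) with hC₁
  set C₂ := 2 * (9 / c + A + L₀ * (b + 1) + 2 * C₁) with hC₂
  have hC₁0 : 0 ≤ C₁ := by positivity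
  have hC₂0 : 0 ≤ C₂ := by positivity
  refine ⟨C₁ + C₂ + 44 * c, by positivity, ?_⟩
  intro n hn Ξ _ D _ f F δ x₀ hf hbdd h1 hvG hδ h2 hvK ε hε hεM hεL m₁ m₂ T hm₁ hm₂ hT
  have hgap0 : 0 ≤ initialGap F x₀ := sub_nonneg.2 (ciInf_le hbdd x₀)
  refine ⟨?_, ?_⟩
  · intro Ω _ P _ ℱ S X τ hrun hτ
    set r := √ε with hrdef
    have hr : 0 < r := Real.sqrt_pos.2 hε
    have hr2 : r ^ 2 = ε := Real.sq_sqrt hε.le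
    have hLr : L₁ * r ≤ 1 := by
      refine le_of_sq_le_sq ?_ zero_le_one
      rw [mul_pow, hr2]
      linarith
    have hMr : M₁ * r ^ 2 ≤ 2 := by
      rw [hr2]
      nlinarith
    have hQ : M₀ + M₁ * L₀ * r ≤ Q := by
      have := mul_le_mul_of_nonneg_right (mul_le_add_one_of_mul_sq_le hM₁ hMr) hL₀.le
      rw [hQdef]
      linarith
    have hεG : 0 ≤ ε * G₁ := by positivity
    have hεK : 0 ≤ ε * K₁ := by positivity
    have hεM₁ : 0 ≤ ε * M₁ := by positivity
    -- `12 a = 18 G₁ + 12 K₁ + 8 M₁` is at most `8/5` of `5 M₁ + 18 G₁ + 12 K₁`, so `12 a ε ≤ 24/5`.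
    have har : a * r ^ 2 ≤ 2 / 5 := by
      rw [hr2, ha]
      linarith
    have hbr : b * r ^ 2 ≤ 2 := by
      rw [hr2, hb]
      linarith
    have hm₁' : 1 / (r ^ 2) ^ 2 ≤ (m₁ : ℝ) := by
      rw [hr2, hm₁]
      exact Nat.le_ceil _
    have hm₂' : 22 * Real.log n / r ^ 2 ≤ (m₂ : ℝ) := by
      rw [hr2, hm₂]
      exact Nat.le_ceil _
    -- A value of `τ` in `Fin T` forces `T ≥ 1`, so a zero gap needs no separate treatment.
    obtain ⟨ω₀⟩ : Nonempty Ω := nonempty_of_isProbabilityMeasure P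
    have hT1 : (1 : ℝ) ≤ T := by
      have : 0 < T := (τ ω₀).pos
      exact_mod_cast this
    have hgapT : initialGap F x₀ ≤ T * r ^ 3 / c := by
      have hle : c * initialGap F x₀ * ε ^ (-(3 / 2) : ℝ) ≤ (T : ℝ) := by
        rw [hT]
        exact Nat.le_ceil _
      rw [Real.rpow_neg hε.le, rpow_three_halves_eq_sqrt_pow hε, ← hrdef, ← div_eq_mul_inv,
        div_le_iff₀ (by positivity)] at hle
      rw [le_div_iff₀ hc]
      linarith
    have hcH : Continuous (hessian F) := h2.continuous_hessian hδ
    have hcG : Continuous fun x => ‖gradient F x‖ := h2.1.2.continuous.norm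
    have hcL : Continuous fun x => lambdaMin (hessian F x) :=
      continuous_lambdaMin_hessian (by omega) h2.1 hcH
    have hsumG := hrun.sum_integral_le_of_descent hn hf hbdd h2.1 hcH hG₀ hG₁ hvG hK₀ hK₁ hvK hr
      hm₁' hm₂' (φ := fun x => 1 / 2 * r * ‖gradient F x‖) (hcG.const_mul _) (Q := Q)
      (κ := 2 / 3 * M₁) (by positivity)
      (fun x g d B hB hd => hd.descent_gradient hL₀.le hL₁ hM₀.le hM₁ hδ hr.le hLr hQ h1 h2 hB)
    have hsumL := hrun.sum_integral_le_of_descent hn hf hbdd h2.1 hcH hG₀ hG₁ hvG hK₀ hK₁ hvK hr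
      hm₁' hm₂' (φ := fun x => -(1 / 2 * r ^ 2 * lambdaMin (hessian F x)))
      (hcL.const_mul _).neg (Q := Q) (κ := 2 * M₁) (by positivity)
      (fun x g d B hB hd => by
        rw [← sub_eq_add_neg]
        exact hd.descent_curvature (by omega) hL₀.le hL₁ hM₀.le hM₁ hδ hr.le hLr hQ h1 h2)
    simp only [integral_neg, integral_const_mul, Finset.sum_neg_distrib, ← Finset.mul_sum]
      at hsumG hsumL
    set G := ∑ t : Fin T, ∫ ω, ‖gradient F (X t.succ ω)‖ ∂P
    set Λ := ∑ t : Fin T, ∫ ω, lambdaMin (hessian F (X t.succ ω)) ∂P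
    have hG0 : 0 ≤ G := Finset.sum_nonneg fun t _ => integral_nonneg fun _ => norm_nonneg _
    have hg₀ := h1.norm_gradient_le_gap hL₀.le hL₁ hbdd x₀ hr hLr
    obtain ⟨hGle, hg₀'⟩ := average_gradient_le hr hc hT1 ha0 har hL₀.le hG0 hgapT hg₀ hsumG
    have hΛle := average_curvature_le hr hc (by linarith) hb0 hbr hL₀.le hC₁0 hgapT hGle hg₀' hsumL
    obtain ⟨hi1, he1⟩ := hτ.integral_comp hcG.measurable
      fun t => hrun.integrable_comp_iterate t hcG
    obtain ⟨hi2, he2⟩ := hτ.integral_comp hcL.measurable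
      fun t => hrun.integrable_comp_iterate t hcL
    refine ⟨hi1, ?_, hi2, ?_⟩
    · rw [he1]
      refine hGle.trans ?_
      rw [hr2]
      gcongr
      linarith
    · rw [he2]
      refine le_trans (neg_le_neg ?_) hΛle
      gcongr
      linarith
  · intro hε1 hge
    refine (sampleCount_le hc hε hε1 hge hm₁ hm₂ hT).trans ?_
    have hlog : 0 ≤ Real.log n := Real.log_natCast_nonneg n
    gcongr
    linarith
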